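/- Let $N\ge 1$ be an integer and let $g,\Delta$ be non-zero real numbers. Define $K_n=K_n(N;g,\Delta)$ by $K_n=0$ for $n\le N$, $K_{N+1}=1$ and $$(n+1)K_{n+1}=\Big(4g^2+n-N+\frac{\Delta^2}{N-n}\Big)K_n-4g^2K_{n-1}\qquad(n>N),$$ and put $$G_+^{(N)}(g,\Delta)=-\frac{2(N+1)}{\Delta}+\sum_{n=N+1}^\infty K_n\Big(1+\frac{\Delta}{n-N}\Big)2^{-(n-N-1)},\qquad G_-^{(N)}(g,\Delta)=G_+^{(N)}(g,-\Delta).$$ (The series converges; in terms of Braak's coefficients $(2g)^{N+1-n}K_n$ the factor $2^{-(n-N-1)}$ becomes $g^{\,n-N-1}$.) Let $$H_{\rm Rabi}=z\frac{d}{dz}+g\Big(z+\frac{d}{dz}\Big)\sigma_x+\Delta\sigma_z,\qquad \sigma_x=\begin{pmatrix}0&1\\1&0\end{pmatrix},\quad \sigma_z=\begin{pmatrix}1&0\\0&-1\end{pmatrix},$$ be the Hamiltonian of the quantum Rabi model on $\mathcal B\otimes\mathbb C^2$, where $\mathcal B$ is the Bargmann space of entire functions $f$ with $\int_{\mathbb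 C}|f(z)|^2e^{-|z|^2}\,dA(z)<\infty$. Let $P_0=1$, $P_1=x+\Delta^2-1$ and $P_k=(kx+\Delta^2-k^2)P_{k-1}-k(k-1)(N-k+1)xP_{k-2}$ for $k\ge2$; $P_N^{(N,0)}(x,\Delta^2):=P_N$ is the constraint polynomial. Put $$\phi_{1,-}(x)=\sum_{n=N+1}^\infty K_nx^n,\qquad \phi_1(x)=\phi_{1,+}(x)=\frac{N+1}{\Delta}x^N-\Delta\sum_{n=N+1}^\infty\frac{K_n}{n-N}x^n .$$ Finally let $e_{1,n}=x^{n-1/4}$ and $e_{2,n}=x^{n+1/4}$ $(n\in\mathbb Z)$ be the bases of the spherical and non-spherical principal series of $\mathfrak{sl}_2$, with $H\mapsto 2x\partial_x+\frac12$, $E\mapsto x^2\partial_x+\frac12(a+\frac12)x$, $F\mapsto-\partial_x+\frac12(a-\frac12)x^{-1}$, and let $\mathbf D^+_{2m}=\bigoplus_{n\ge m}\mathbb Ce_{1,n}$, $\mathbf D^+_{2m+1}=\bigoplus_{n\ge m}\mathbb Ce_{2,n}$ be the discrete series modules (invariant for $a=2m$, resp. $a=2m+1$). **Proposition.** If $G_+^{(N)}(g,\Delta)=0$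 or $G_-^{(N)}(g,\Delta)=0$, then: 1. $P_N^{(N,0)}(4g^2,\Delta^2)\ne0$. 2. $\lambda=N-g^2$ is a non-degenerate exceptional eigenvalue of $H_{\rm Rabi}$, that is, an eigenvalue of the form $M-g^2$ with an integer $M\ge 0$ and with a one-dimensional eigenspace. 3. The series $\phi_{1,\pm}$ give the eigenvector: the eigenspace is spanned by $\psi=(\psi_1,\psi_2)$ with $\psi_1\pm\psi_2=e^{-gz}\phi_{1,\pm}\big(\tfrac{z+g}{2g}\big)$. 4. The corresponding vector $\nu_{\phi_1}(x)=x^{\frac12(a-\frac12)}\phi_1(x)$, $a=-(\lambda+g^2)=-N$, lies in (the completion of) $\mathbf D^+_N$: it is the sum, for every complex $x\neq0$ (principal branches), of a series $\sum_n c_ne_{j,n}(x)$ ($j=1$ for even $N$, $j=2$ for odd $N$) whose formal series lies in the closure of $\mathbf D^+_N$ for coefficientwise convergence. -/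

import Mathlib

open MeasureTheory

noncomputable section

namespace Rabi

/-! ### The quantum Rabi model in the Bargmann representation -/

/-- The Bargmann space: entire functions `f` with `∫ |f z|² exp (-|z|²) < ∞`. -/
def bargmannSpace : Submodule ℂ (ℂ → ℂ) where
  carrier := {f | Differentiable ℂ f ∧
    Integrable (fun z : ℂ => ‖f z‖ ^ 2 * Real.exp (-‖z‖ ^ 2)) volume}
  zero_mem' := by
    refine ⟨differentiable_const 0, ?_⟩
    simp
  add_mem' := by
    rintro f h ⟨hf, hf'⟩ ⟨hh, hh'⟩
    refine ⟨hf.add hh, ?_⟩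
    refine ((hf'.add hh').const_mul 2).mono' ?_ (Filter.Eventually.of_forall fun z => ?_)
    · have h1 : Continuous (f + h) := (hf.add hh).continuous
      exact Continuous.aestronglyMeasurable (by fun_prop)
    · have h1 : ‖f z + h z‖ ^ 2 ≤ 2 * (‖f z‖ ^ 2 + ‖h z‖ ^ 2) := by
        have h2 := norm_add_le (f z) (h z)
        have h3 := norm_nonneg (f z + h z)
        nlinarith [sq_nonneg (‖f z‖ - ‖h z‖)]
      have h4 := (Real.exp_pos (-‖z‖ ^ 2)).le
      rw [Real.norm_of_nonneg (by positivity)]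
      simp only [Pi.add_apply]
      nlinarith [mul_le_mul_of_nonneg_right h1 h4]
  smul_mem' := by
    rintro c f ⟨hf, hf'⟩
    refine ⟨hf.const_smul c, (hf'.const_mul (‖c‖ ^ 2)).congr
      (Filter.Eventually.of_forall fun z => ?_)⟩
    simp only [Pi.smul_apply, smul_eq_mul, norm_mul]
    ring

/-- The Pauli matrix `σ_x`. -/
def pauliX : Matrix (Fin 2) (Fin 2) ℂ := !![0, 1; 1, 0]

/-- The Pauli matrix `σ_z`. -/
def pauliZ : Matrix (Fin 2) (Fin 2) ℂ := !![1, 0; 0, -1]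

/-- The Hamiltonian `z d/dz + g (z + d/dz) σ_x + Δ σ_z` of the quantum Rabi model (with `ω = 1`)
in the Bargmann representation, acting on two-component functions. -/
def hamiltonian (g Δ : ℝ) (ψ : Fin 2 → ℂ → ℂ) : Fin 2 → ℂ → ℂ := fun i z =>
  z * deriv (ψ i) z + (g : ℂ) * ∑ k, pauliX i k * (z * ψ k z + deriv (ψ k) z)
    + (Δ : ℂ) * ∑ k, pauliZ i k * ψ k z

/-- The eigenspace of the Hamiltonian for `lam`, inside two copies of the Bargmann space. -/
def eigenspace (g Δ lam : ℝ) : Submodule ℂ (Fin 2 → ℂ → ℂ) where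
  carrier := {ψ | (∀ i, ψ i ∈ bargmannSpace) ∧ hamiltonian g Δ ψ = (lam : ℂ) • ψ}
  zero_mem' := by
    refine ⟨fun i => bargmannSpace.zero_mem, ?_⟩
    have h0 : deriv (0 : ℂ → ℂ) = 0 := by ext z; exact deriv_const z 0
    ext i z
    simp [hamiltonian, h0]
  add_mem' := by
    rintro ψ χ ⟨h1, h2⟩ ⟨h3, h4⟩
    refine ⟨fun i => bargmannSpace.add_mem (h1 i) (h3 i), ?_⟩
    rw [smul_add, ← h2, ← h4]
    ext i z
    have hd : ∀ k, deriv (ψ k + χ k) z = deriv (ψ k) z + deriv (χ k) z := fun k =>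
      deriv_add ((h1 k).1 z) ((h3 k).1 z)
    simp only [hamiltonian, Pi.add_apply, Fin.sum_univ_two, hd]
    ring
  smul_mem' := by
    rintro c ψ ⟨h1, h2⟩
    refine ⟨fun i => bargmannSpace.smul_mem c (h1 i), ?_⟩
    rw [smul_comm, ← h2]
    ext i z
    have hd : ∀ k, deriv (c • ψ k) z = c * deriv (ψ k) z := fun k =>
      deriv_const_smul c ((h1 k).1 z)
    simp only [hamiltonian, Pi.smul_apply, smul_eq_mul, Fin.sum_univ_two, hd]
    ring

/-- `lam` is a non-degenerate exceptional eigenvalue: it has the form `M - g ^ 2` with an integer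
`M ≥ 0`, and its eigenspace is one-dimensional. -/
def IsNondegenerateExceptional (g Δ lam : ℝ) : Prop :=
  (∃ M : ℕ, lam = M - g ^ 2) ∧ Module.finrank ℂ (eigenspace g Δ lam) = 1

/-- The polynomials `P_k^{(N, 0)}(x, Δ²)`, evaluated at `x` and `y = Δ²`. The constraint polynomial
is the one with `k = N`. -/
def constraintP (N : ℕ) (x y : ℝ) : ℕ → ℝ
  | 0 => 1
  | 1 => x + y - 1
  | k + 2 => ((k + 2 : ℝ) * x + y - (k + 2 : ℝ) ^ 2) * constraintP N x y (k + 1)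
      - (k + 2 : ℝ) * (k + 1) * ((N : ℝ) - (k + 2) + 1) * x * constraintP N x y k

/-! ### The coefficients `K_n` and the `G`-functions -/

/-- The coefficients `K_n = K_n(N; g, Δ)`: `K_n = 0` for `n ≤ N`, `K_{N+1} = 1`, and a three-term
recursion for `n > N`, see `coeffK_succ`. -/
def coeffK (N : ℕ) (g Δ : ℝ) : ℕ → ℝ
  | 0 => 0
  | 1 => if N = 0 then 1 else 0
  | n + 2 =>
    if n + 1 < N then 0
    else if n + 1 = N then 1
    else ((4 * g ^ 2 + ((n + 1 : ℕ) : ℝ) - N + Δ ^ 2 / ((N : ℝ) - ((n + 1 : ℕ) : ℝ)))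
        * coeffK N g Δ (n + 1) - 4 * g ^ 2 * coeffK N g Δ n) / ((n : ℝ) + 2)

theorem coeffK_of_le {N : ℕ} (g Δ : ℝ) {n : ℕ} (h : n ≤ N) : coeffK N g Δ n = 0 := by
  match n, h with
  | 0, _ => rfl
  | 1, h => simp [coeffK]; omega
  | n + 2, h => rw [coeffK, if_pos (by omega)]

theorem coeffK_init (N : ℕ) (g Δ : ℝ) : coeffK N g Δ (N + 1) = 1 := by
  match N with
  | 0 => simp [coeffK]
  | N + 1 => rw [coeffK, if_neg (by omega), if_pos rfl]

theorem coeffK_succ {N : ℕ} (g Δ : ℝ) {n : ℕ} (h : N < n) :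
    ((n : ℝ) + 1) * coeffK N g Δ (n + 1)
      = (4 * g ^ 2 + n - N + Δ ^ 2 / ((N : ℝ) - n)) * coeffK N g Δ n
        - 4 * g ^ 2 * coeffK N g Δ (n - 1) := by
  match n, h with
  | n + 1, h =>
    rw [coeffK, if_neg (by omega), if_neg (by omega), Nat.add_sub_cancel]
    have h2 : (n : ℝ) + 2 ≠ 0 := by positivity
    have h3 : ((n + 1 : ℕ) : ℝ) + 1 = (n : ℝ) + 2 := by push_cast; ring
    rw [h3, mul_div_cancel₀ _ h2]

/-- `G_+^{(N)}(g, Δ) = -2(N+1)/Δ + ∑_{n ≥ N+1} K_n (1 + Δ/(n-N)) 2^{-(n-N-1)}`, summed over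
`k = n - N - 1`. The power series `∑ K_n xⁿ` converges for `|x| < 1`. -/
def GPlus (N : ℕ) (g Δ : ℝ) : ℝ :=
  -(2 * ((N : ℝ) + 1) / Δ)
    + ∑' k : ℕ, coeffK N g Δ (N + 1 + k) * (1 + Δ / ((k : ℝ) + 1)) * (1 / 2) ^ k

/-- `G_-^{(N)}(g, Δ) = G_+^{(N)}(g, -Δ)`. -/
def GMinus (N : ℕ) (g Δ : ℝ) : ℝ := GPlus N g (-Δ)

/-- `φ_{1,-}(x) = ∑_{n ≥ N+1} K_n xⁿ`. -/
def phiMinus (N : ℕ) (g Δ : ℝ) (x : ℂ) : ℂ :=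
  ∑' k : ℕ, (coeffK N g Δ (N + 1 + k) : ℂ) * x ^ (N + 1 + k)

/-- `φ_1(x) = φ_{1,+}(x) = (N+1)/Δ x^N - Δ ∑_{n ≥ N+1} K_n/(n-N) xⁿ`. -/
def phiPlus (N : ℕ) (g Δ : ℝ) (x : ℂ) : ℂ :=
  ((N : ℂ) + 1) / (Δ : ℂ) * x ^ N
    - (Δ : ℂ) * ∑' k : ℕ, (coeffK N g Δ (N + 1 + k) : ℂ) / ((k : ℂ) + 1) * x ^ (N + 1 + k)

/-- The two-component function `ψ = (ψ₁, ψ₂)` with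
`ψ₁ ± ψ₂ = f_± = exp (-g z) φ_{1,±}((z + g) / (2 g))`. -/
def eigenstate (N : ℕ) (g Δ : ℝ) : Fin 2 → ℂ → ℂ := fun i z =>
  let x : ℂ := (z + g) / (2 * g)
  let fPlus : ℂ := Complex.exp (-(g * z)) * phiPlus N g Δ x
  let fMinus : ℂ := Complex.exp (-(g * z)) * phiMinus N g Δ x
  ![(fPlus + fMinus) / 2, (fPlus - fMinus) / 2] i

/-! ### Principal series and discrete series of `sl₂` -/

/-- The two families of principal series: spherical (`j = 1`), non-spherical (`j = 2`). -/
inductive Family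
  | spherical
  | nonspherical

/-- The exponent `∓ 1/4` in `V_1 = x^{-1/4} ℂ[x, x⁻¹]` and `V_2 = x^{1/4} ℂ[x, x⁻¹]`. -/
def Family.shift : Family → ℂ
  | .spherical => -1 / 4
  | .nonspherical => 1 / 4

/-- The basis functions `e_{1,n} = x^{n - 1/4}` and `e_{2,n} = x^{n + 1/4}` (principal branch). -/
def basisFun (j : Family) (n : ℤ) (x : ℂ) : ℂ := x ^ ((n : ℂ) + j.shift)

/-- Formal two-sided series `∑_n c_n e_{j,n}`, identified with their coefficient sequences; the
topology is that of coefficientwise convergence. -/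
abbrev FormalSeries := ℤ → ℂ

/-- `ϖ_a(H) = 2 x ∂_x + 1/2`, so that `e_{1,n} ↦ 2n e_{1,n}` and `e_{2,n} ↦ (2n+1) e_{2,n}`. -/
def opH (j : Family) : Module.End ℂ FormalSeries where
  toFun c n := (2 * ((n : ℂ) + j.shift) + 1 / 2) * c n
  map_add' c d := by ext n; simp; ring
  map_smul' r c := by ext n; simp; ring

/-- `ϖ_a(E) = x² ∂_x + (a + 1/2) x / 2`, so that `e_{1,n} ↦ (n + a/2) e_{1,n+1}` and
`e_{2,n} ↦ (n + (a+1)/2) e_{2,n+1}`. -/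
def opE (j : Family) (a : ℂ) : Module.End ℂ FormalSeries where
  toFun c n := (((n - 1 : ℤ) : ℂ) + j.shift + (a + 1 / 2) / 2) * c (n - 1)
  map_add' c d := by ext n; simp; ring
  map_smul' r c := by ext n; simp; ring

/-- `ϖ_a(F) = -∂_x + (a - 1/2) x⁻¹ / 2`, so that `e_{1,n} ↦ (-n + a/2) e_{1,n-1}` and
`e_{2,n} ↦ (-n + (a-1)/2) e_{2,n-1}`. -/
def opF (j : Family) (a : ℂ) : Module.End ℂ FormalSeries where
  toFun c n := (-(((n + 1 : ℤ) : ℂ) + j.shift) + (a - 1 / 2) / 2) * c (n + 1)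
  map_add' c d := by ext n; simp; ring
  map_smul' r c := by ext n; simp; ring

attribute [local instance] LieRing.ofAssociativeRing

/-- The representation `ϖ_{j,a}` of `sl₂(ℂ)`, written on formal series. -/
def varpi (j : Family) (a : ℂ) :
    LieAlgebra.SpecialLinear.sl (Fin 2) ℂ →ₗ⁅ℂ⁆ Module.End ℂ FormalSeries where
  toFun X := X.1 0 0 • opH j + X.1 0 1 • opE j a + X.1 1 0 • opF j a
  map_add' X Y := by
    change (X.1 0 0 + Y.1 0 0) • opH j + (X.1 0 1 + Y.1 0 1) • opE j a
      + (X.1 1 0 + Y.1 1 0) • opF j a = _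
    simp only [add_smul]
    abel
  map_smul' r X := by
    change (r * X.1 0 0) • opH j + (r * X.1 0 1) • opE j a + (r * X.1 1 0) • opF j a = _
    simp only [RingHom.id_apply, smul_add, smul_smul]
  map_lie' := by
    intro X Y
    have hX : X.1 1 1 = -X.1 0 0 := by
      have h : Matrix.trace X.1 = 0 := X.2
      rw [Matrix.trace_fin_two] at h
      linear_combination h
    have hY : Y.1 1 1 = -Y.1 0 0 := by
      have h : Matrix.trace Y.1 = 0 := Y.2
      rw [Matrix.trace_fin_two] at h
      linear_combination h
    refine LinearMap.ext fun c => funext fun n => ?_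
    have e1 : n - 1 + 1 = n := by ring
    have e2 : n + 1 - 1 = n := by ring
    simp only [LieAlgebra.SpecialLinear.sl_bracket, Ring.lie_def, Matrix.sub_apply, Matrix.mul_apply,
      Fin.sum_univ_two, LinearMap.sub_apply, Module.End.mul_apply, LinearMap.add_apply,
      LinearMap.smul_apply, Pi.add_apply, Pi.sub_apply, Pi.smul_apply, smul_eq_mul, opH, opE, opF,
      LinearMap.coe_mk, AddHom.coe_mk, hX, hY, e1, e2]
    push_cast
    ring

/-- The vector `e_{j,n}`. -/
def basisVec (n : ℤ) : FormalSeries := Pi.single n 1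

/-- The family that contains `D^+_N`: spherical for even `N`, non-spherical for odd `N`. -/
def familyOf (N : ℕ) : Family := if Even N then .spherical else .nonspherical

/-- `D^+_N`, the span of the `e_{1,n}` with `n ≥ m` if `N = 2m`, and of the `e_{2,n}` with `n ≥ m`
if `N = 2m + 1`. -/
def discreteSeriesPlus (N : ℕ) : Submodule ℂ FormalSeries :=
  Submodule.span ℂ {v | ∃ n : ℤ, ((N / 2 : ℕ) : ℤ) ≤ n ∧ v = basisVec n}

theorem opH_basisVec (j : Family) (n : ℤ) :
    opH j (basisVec n) = (2 * ((n : ℂ) + j.shift) + 1 / 2) • basisVec n := by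
  ext k
  by_cases h : k = n
  · subst h; simp [opH, basisVec]
  · simp [opH, basisVec, h]

theorem opE_basisVec (j : Family) (a : ℂ) (n : ℤ) :
    opE j a (basisVec n) = ((n : ℂ) + j.shift + (a + 1 / 2) / 2) • basisVec (n + 1) := by
  ext k
  by_cases h : k = n + 1
  · subst h; simp [opE, basisVec]
  · have h' : k - 1 ≠ n := fun h'' => h (by omega)
    simp [opE, basisVec, h, h']

theorem opF_basisVec (j : Family) (a : ℂ) (n : ℤ) :
    opF j a (basisVec n) = (-((n : ℂ) + j.shift) + (a - 1 / 2) / 2) • basisVec (n - 1) := by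
  ext k
  by_cases h : k = n - 1
  · subst h; simp [opF, basisVec]; ring
  · have h' : k + 1 ≠ n := fun h'' => h (by omega)
    simp [opF, basisVec, h, h']

/-- `D^+_N` is invariant under `ϖ_{j,N}`. -/
theorem discreteSeriesPlus_invariant (N : ℕ) (X : LieAlgebra.SpecialLinear.sl (Fin 2) ℂ)
    {v : FormalSeries} (hv : v ∈ discreteSeriesPlus N) :
    varpi (familyOf N) N X v ∈ discreteSeriesPlus N := by
  induction hv using Submodule.span_induction with
  | zero => simp
  | add v w _ _ h1 h2 => rw [map_add]; exact add_mem h1 h2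
  | smul c v _ h => rw [map_smul]; exact Submodule.smul_mem _ c h
  | mem v h =>
    obtain ⟨n, hn, rfl⟩ := h
    have hmem : ∀ k : ℤ, ((N / 2 : ℕ) : ℤ) ≤ k → basisVec k ∈ discreteSeriesPlus N :=
      fun k hk => Submodule.subset_span ⟨k, hk, rfl⟩
    change (X.1 0 0 • opH _ + X.1 0 1 • opE _ _ + X.1 1 0 • opF _ _) (basisVec n) ∈ _
    simp only [LinearMap.add_apply, LinearMap.smul_apply, opH_basisVec, opE_basisVec, opF_basisVec]
    refine add_mem (add_mem ?_ ?_) ?_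
    · exact Submodule.smul_mem _ _ (Submodule.smul_mem _ _ (hmem n hn))
    · exact Submodule.smul_mem _ _ (Submodule.smul_mem _ _ (hmem _ (by omega)))
    · rcases hn.lt_or_eq with h | h
      · exact Submodule.smul_mem _ _ (Submodule.smul_mem _ _ (hmem _ (by omega)))
      · have hz : -((n : ℂ) + (familyOf N).shift) + ((N : ℂ) - 1 / 2) / 2 = 0 := by
          rw [← h]
          rcases Nat.even_or_odd' N with ⟨m, hm | hm⟩
          · have h2 : N / 2 = m := by omega
            have h3 : Even N := ⟨m, by omega⟩
            rw [h2, familyOf, if_pos h3, Family.shift, hm]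
            push_cast
            ring
          · have h2 : N / 2 = m := by omega
            have h3 : ¬ Even N := by rw [Nat.not_even_iff_odd]; exact ⟨m, hm⟩
            rw [h2, familyOf, if_neg h3, Family.shift, hm]
            push_cast
            ring
        rw [hz]
        simp

/-- A function on `ℂ ∖ {0}` lies in (the completion of) `D^+_N` if it is the sum of a series
`∑_n c_n e_{j,n}`, convergent at every point, whose formal series is in the closure of the
algebraic direct sum `D^+_N`. -/
def InDiscreteSeriesPlus (N : ℕ) (ν : ℂ → ℂ) : Prop :=
  ∃ c ∈ (discreteSeriesPlus N).topologicalClosure,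
    ∀ x : ℂ, x ≠ 0 → HasSum (fun n : ℤ => c n * basisFun (familyOf N) n x) (ν x)

/-- `ν_{φ_1} = x^{(a - 1/2)/2} φ_1(x)` with `a = -(lam + g²) = -N`. -/
def nuVec (N : ℕ) (g Δ : ℝ) (x : ℂ) : ℂ :=
  x ^ ((-(N : ℂ) - 1 / 2) / 2) * phiPlus N g Δ x

end Rabi

end

/-! In the variable x = (z+g)/(2g), removing the factor exp(-gz) turns the eigenvalue equation for N
- g² into the first-order system `SolvesAt` with c = 4g² and regular singular points 0 and 1. The
pair (φ_{1,+}, φ_{1,-}) is a power series solution at 0, which a priori converges only for |x| < 1.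
Parity acts on solutions by (u, v)(x) ↦ exp(cx - c/2) (v(1-x), u(1-x)) (`SolvesAt.reflect`). It
fixes the point 1/2, and G_± equals φ_{1,-}(1/2) ∓ φ_{1,+}(1/2) up to a power of 2 (`GPlus_eq`).

Hence if G_± vanishes, uniqueness for the ODE on (0,1) makes the solution an eigenfunction of parity
(`parity_eigen`), and φ_{1,-} inherits at 1 the smoothness of φ_{1,+} at 0. A solution of the
recursion for K_n either decays factorially or has eventually constant sign and at most polynomial
decay (`minimal_or_dominant`). In the second case some derivative of the sum blows up at 1
(`not_contDiffAt_one_of_dominant`). So K_n is minimal, both series are entire of exponential type,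
and the resulting spinor lies in the Bargmann space.

For part 1, suppose P_N = 0. Then the system has a polynomial (Juddian) solution. Adding ± its
reflection gives a solution proportional to φ_1, whose + component has the form p(x) + exp(cx) r(x)
with deg p ≤ N and deg r < N. It vanishes to order N at 0 and N+1 at 1, one condition more than a
nonzero function of this form allows (`eq_zero_of_expPoly_vanishing`), while r(1) ≠ 0.

Non-degeneracy then follows from P_N ≠ 0. An eigenfunction gives entire power series (b, a) solving
the system, and the continuant identity N!² a_N = P_N a_0 (`constraint_mul_eq`) together with Δ a_N
= 0 forces a_0 = 0, which leaves b_N as the only free constant. The statement about the discrete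
series is a shift of exponents. -/

noncomputable section

namespace Rabi

/-! ### Power series over ℝ and ℂ: termwise differentiation, smoothness, uniqueness of coefficients.
-/

section PowerSeries

variable {𝕜 : Type*} [RCLike 𝕜]

/-- The sum of the power series with coefficients `a`. -/
def powerSum (a : ℕ → 𝕜) (x : 𝕜) : 𝕜 := ∑' n, a n * x ^ n

/-- The power series with coefficients `a` converges absolutely for `‖x‖ < R`. -/
def ConvergesOn (a : ℕ → 𝕜) (R : ℝ) : Prop :=
  ∀ r : ℝ, 0 ≤ r → r < R → Summable fun n => ‖a n‖ * r ^ n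

/-- The coefficients of the derivative of a power series. -/
def derivCoeff (a : ℕ → 𝕜) (n : ℕ) : 𝕜 := ((n : 𝕜) + 1) * a (n + 1)

/-- The coefficients of `x` times a power series. -/
def shiftCoeff (a : ℕ → 𝕜) : ℕ → 𝕜
  | 0 => 0
  | n + 1 => a n

variable {a : ℕ → 𝕜} {R : ℝ} {x : 𝕜}

theorem ConvergesOn.hasSum (h : ConvergesOn a R) (hx : ‖x‖ < R) :
    HasSum (fun n => a n * x ^ n) (powerSum a x) := by
  refine Summable.hasSum (Summable.of_norm ?_)
  simpa only [norm_mul, norm_pow] using h ‖x‖ (norm_nonneg x) hx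

/-- Comparison at an intermediate radius s with r < s < R: the factor (n+1)(r/s)^n is bounded, so
the linear growth from differentiation costs nothing. -/
theorem ConvergesOn.derivCoeff (h : ConvergesOn a R) : ConvergesOn (derivCoeff a) R := by
  intro r h0 hr
  obtain ⟨s, hrs, hsR⟩ := exists_between hr
  have hs : 0 < s := h0.trans_lt hrs
  have h1 : Summable fun n : ℕ => ‖a (n + 1)‖ * s ^ (n + 1) :=
    (summable_nat_add_iff 1).mpr (h s hs.le hsR)
  have hρ : r / s < 1 := (div_lt_one hs).mpr hrs
  have hρ0 : 0 ≤ r / s := by positivity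
  have h2 : Summable fun n : ℕ => ((n : ℝ) + 1) * (r / s) ^ n := by
    have h3 := summable_pow_mul_geometric_of_norm_lt_one (R := ℝ) 1 (r := r / s)
      (by rwa [Real.norm_of_nonneg hρ0])
    have h4 := summable_geometric_of_lt_one hρ0 hρ
    refine (h3.add h4).congr fun n => ?_
    ring
  obtain ⟨M, hM⟩ : ∃ M, ∀ n : ℕ, ((n : ℝ) + 1) * (r / s) ^ n ≤ M :=
    ⟨_, fun n => h2.le_tsum n fun j _ => by positivity⟩
  refine Summable.of_nonneg_of_le (fun n => by positivity) (fun n => ?_)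
    (h1.mul_left (M / s))
  have h5 : ‖Rabi.derivCoeff a n‖ = ((n : ℝ) + 1) * ‖a (n + 1)‖ := by
    have h6 : ‖((n : 𝕜) + 1)‖ = (n : ℝ) + 1 := by
      rw [← Nat.cast_succ, RCLike.norm_natCast, Nat.cast_succ]
    rw [Rabi.derivCoeff, norm_mul, h6]
  rw [h5]
  calc ((n : ℝ) + 1) * ‖a (n + 1)‖ * r ^ n
      = (((n : ℝ) + 1) * (r / s) ^ n) * (‖a (n + 1)‖ * s ^ n) := by
        rw [div_pow]; field_simp
    _ ≤ M * (‖a (n + 1)‖ * s ^ n) := mul_le_mul_of_nonneg_right (hM n) (by positivity)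
    _ = M / s * (‖a (n + 1)‖ * s ^ (n + 1)) := by rw [pow_succ]; field_simp

theorem ConvergesOn.hasDerivAt (h : ConvergesOn a R) (hx : ‖x‖ < R) :
    HasDerivAt (powerSum a) (powerSum (Rabi.derivCoeff a) x) x := by
  obtain ⟨r, hxr, hrR⟩ := exists_between hx
  have hr : 0 < r := (norm_nonneg x).trans_lt hxr
  have hD := h.derivCoeff r hr.le hrR
  have hu : Summable fun n : ℕ => ‖Rabi.derivCoeff a (n - 1)‖ * r ^ (n - 1) := by
    rw [← summable_nat_add_iff 1]
    simpa using hD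
  have hg : ∀ (n : ℕ) (y : 𝕜), y ∈ Metric.ball (0 : 𝕜) r →
      HasDerivAt (fun z => a n * z ^ n) (a n * ((n : 𝕜) * y ^ (n - 1))) y :=
    fun n y _ => (hasDerivAt_pow n y).const_mul (a n)
  have key := hasDerivAt_tsum_of_isPreconnected hu Metric.isOpen_ball
    (Metric.isPreconnected_ball (x := (0 : 𝕜)) (r := r)) hg (fun n y hy => ?_)
    (Metric.mem_ball_self hr) ?_ (y := x) (by simpa using hxr)
  · have h1 : HasSum (fun n : ℕ => a n * ((n : 𝕜) * x ^ (n - 1)))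
        (powerSum (Rabi.derivCoeff a) x) := by
      have h2 := h.derivCoeff.hasSum hx
      refine (hasSum_nat_add_iff' 1).mp ?_
      simpa [Rabi.derivCoeff, mul_comm, mul_left_comm, mul_assoc] using h2
    rw [h1.tsum_eq] at key
    exact key
  · rcases n with _ | n
    · simp
    · have hy' : ‖y‖ ≤ r := by simpa using (Metric.mem_ball.mp hy).le
      have h3 : a (n + 1) * (((n + 1 : ℕ) : 𝕜) * y ^ (n + 1 - 1))
          = Rabi.derivCoeff a n * y ^ n := by
        simp only [Rabi.derivCoeff, Nat.add_sub_cancel]; push_cast; ring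
      rw [h3, norm_mul, norm_pow, Nat.add_sub_cancel]
      gcongr
  · exact (h.hasSum (x := 0) (by simpa using hr.trans hrR)).summable

theorem ConvergesOn.hasSum_natCast_mul (h : ConvergesOn a R) (hx : ‖x‖ < R) :
    HasSum (fun n : ℕ => (n : 𝕜) * a n * x ^ n) (x * powerSum (Rabi.derivCoeff a) x) := by
  refine (hasSum_nat_add_iff' 1).mp ?_
  have h2 := (h.derivCoeff.hasSum hx).mul_left x
  simp only [Rabi.derivCoeff] at h2
  simp only [Finset.range_one, Finset.sum_singleton, Nat.cast_zero, zero_mul, sub_zero]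
  refine h2.congr_fun fun n => ?_
  push_cast
  ring

theorem ConvergesOn.hasSum_shiftCoeff (h : ConvergesOn a R) (hx : ‖x‖ < R) :
    HasSum (fun n : ℕ => shiftCoeff a n * x ^ n) (x * powerSum a x) := by
  refine (hasSum_nat_add_iff' 1).mp ?_
  have h2 := (h.hasSum hx).mul_left x
  simp only [Finset.range_one, Finset.sum_singleton, shiftCoeff, zero_mul, sub_zero]
  refine h2.congr_fun fun n => ?_
  ring

theorem powerSum_zero (a : ℕ → 𝕜) : powerSum a 0 = a 0 := by
  rw [powerSum, tsum_eq_single 0 fun n hn => by simp [hn]]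
  simp

/-- Multiplying through by n! avoids dividing factorials. -/
theorem factorial_mul_derivCoeff_iterate (a : ℕ → 𝕜) (m n : ℕ) :
    (n.factorial : 𝕜) * Rabi.derivCoeff^[m] a n = ((n + m).factorial : 𝕜) * a (n + m) := by
  induction m generalizing n with
  | zero => simp
  | succ m ih =>
    rw [Function.iterate_succ_apply']
    have := ih (n + 1)
    rw [show n + 1 + m = n + (m + 1) by ring] at this
    rw [← this, Rabi.derivCoeff, Nat.factorial_succ]
    push_cast
    ring

theorem derivCoeff_iterate_zero (a : ℕ → 𝕜) (m : ℕ) :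
    Rabi.derivCoeff^[m] a 0 = (m.factorial : 𝕜) * a m := by
  simpa using factorial_mul_derivCoeff_iterate a m 0

theorem ConvergesOn.derivCoeff_iterate (h : ConvergesOn a R) (m : ℕ) :
    ConvergesOn (Rabi.derivCoeff^[m] a) R := by
  induction m with
  | zero => exact h
  | succ m ih => rw [Function.iterate_succ_apply']; exact ih.derivCoeff

theorem ConvergesOn.iteratedDeriv_eq (h : ConvergesOn a R) (m : ℕ) (hx : ‖x‖ < R) :
    iteratedDeriv m (powerSum a) x = powerSum (Rabi.derivCoeff^[m] a) x := by
  induction m generalizing x with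
  | zero => simp
  | succ m ih =>
    rw [iteratedDeriv_succ, Function.iterate_succ_apply',
      ← ((h.derivCoeff_iterate m).hasDerivAt hx).deriv]
    refine Filter.EventuallyEq.deriv_eq ?_
    have ho : IsOpen {y : 𝕜 | ‖y‖ < R} := isOpen_lt continuous_norm continuous_const
    filter_upwards [ho.mem_nhds hx] with y hy using ih hy

theorem ConvergesOn.contDiffAt (h : ConvergesOn a R) (m : ℕ) (hx : ‖x‖ < R) :
    ContDiffAt 𝕜 m (powerSum a) x := by
  have ho : IsOpen {y : 𝕜 | ‖y‖ < R} := isOpen_lt continuous_norm continuous_const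
  suffices H : ContDiffOn 𝕜 m (powerSum a) {y : 𝕜 | ‖y‖ < R} from H.contDiffAt (ho.mem_nhds hx)
  clear hx
  induction m generalizing a with
  | zero =>
    rw [Nat.cast_zero, contDiffOn_zero]
    exact fun y hy => (h.hasDerivAt hy).continuousAt.continuousWithinAt
  | succ m ih =>
    rw [Nat.cast_succ, contDiffOn_succ_iff_deriv_of_isOpen ho]
    refine ⟨fun y hy => (h.hasDerivAt hy).differentiableAt.differentiableWithinAt, by simp, ?_⟩
    exact (ih h.derivCoeff).congr fun y hy => (h.hasDerivAt hy).deriv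

theorem coeff_eq_zero_of_powerSum_eq_zero (h : ConvergesOn a R) (hR : 0 < R)
    (h0 : ∀ x : 𝕜, ‖x‖ < R → powerSum a x = 0) (n : ℕ) : a n = 0 := by
  have h1 := h.iteratedDeriv_eq n (x := 0) (by simpa using hR)
  rw [powerSum_zero, derivCoeff_iterate_zero] at h1
  have ho : IsOpen {y : 𝕜 | ‖y‖ < R} := isOpen_lt continuous_norm continuous_const
  have h2 : powerSum a =ᶠ[nhds 0] fun _ => 0 := by
    filter_upwards [ho.mem_nhds (show (0 : 𝕜) ∈ _ by simpa using hR)] with y hy using h0 y hy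
  rw [h2.iteratedDeriv_eq n] at h1
  have h3 : (n.factorial : 𝕜) ≠ 0 := Nat.cast_ne_zero.mpr n.factorial_ne_zero
  have h4 : iteratedDeriv n (fun _ : 𝕜 => (0 : 𝕜)) 0 = 0 := by
    simp
  rw [h4] at h1
  exact (mul_eq_zero.mp h1.symm).resolve_left h3

end PowerSeries

theorem continuousAt_iteratedDeriv {n : ℕ} {f : ℝ → ℝ} {x : ℝ} (hf : ContDiffAt ℝ n f x) :
    ContinuousAt (iteratedDeriv n f) x := by
  rw [iteratedDeriv_eq_equiv_comp]
  exact (LinearIsometryEquiv.continuous _).continuousAt.comp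
    (hf.continuousAt_iteratedFDeriv (le_refl _))

/-! ### Asymptotic dichotomy for the three-term recursion. -/

section Recurrence

variable {u : ℕ → ℝ} {C : ℝ} {n₀ : ℕ}

/-- The maximum of two consecutive terms eventually grows by a factor arbitrarily close to 1 at each
step. -/
theorem convergesOn_one_of_recurrence (hC : 0 < C)
    (h : ∀ n ≥ n₀, |u (n + 2) - u (n + 1)| ≤ C / (n + 2) * (|u (n + 1)| + |u n|)) :
    ConvergesOn u 1 := by
  intro r h0 hr
  -- Any growth rate s > 1 with s r < 1 would do.
  set s : ℝ := 2 / (1 + r) with hs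
  have hs1 : 1 < s := by rw [hs, lt_div_iff₀ (by positivity)]; linarith
  have hsr : s * r < 1 := by
    rw [hs, div_mul_eq_mul_div, div_lt_one (by positivity)]; linarith
  obtain ⟨k, hk⟩ := exists_nat_gt (2 * C / (s - 1))
  set n₁ := max n₀ k with hn₁
  have hstep : ∀ n ≥ n₁, max |u (n + 2)| |u (n + 1)| ≤ s * max |u (n + 1)| |u n| := by
    intro n hn
    have h1 := h n (le_trans (le_max_left _ _) hn)
    have hkn : (k : ℝ) ≤ n := by exact_mod_cast le_trans (le_max_right _ _) hn
    have h2 : C / (n + 2) ≤ (s - 1) / 2 := by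
      rw [div_lt_iff₀ (by linarith)] at hk
      rw [div_le_iff₀ (by positivity)]
      nlinarith
    set M := max |u (n + 1)| |u n| with hM
    have h3 : |u (n + 1)| ≤ M := le_max_left _ _
    have h4 : |u n| ≤ M := le_max_right _ _
    have hM0 : 0 ≤ M := (abs_nonneg _).trans h3
    have h5 : |u (n + 2)| ≤ |u (n + 1)| + |u (n + 2) - u (n + 1)| := by
      have := abs_add_le (u (n + 1)) (u (n + 2) - u (n + 1))
      simpa using this
    have h6 : C / (n + 2) * (|u (n + 1)| + |u n|) ≤ (s - 1) / 2 * (M + M) := by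
      gcongr
    refine max_le (by linarith) ?_
    nlinarith
  have hbound : ∀ j : ℕ, max |u (n₁ + j + 1)| |u (n₁ + j)|
      ≤ s ^ j * max |u (n₁ + 1)| |u n₁| := by
    intro j
    induction j with
    | zero => simp
    | succ j ih =>
      refine (hstep (n₁ + j) (by omega)).trans ?_
      rw [pow_succ, mul_comm (s ^ j), mul_assoc]
      exact mul_le_mul_of_nonneg_left ih (by linarith)
  rw [← summable_nat_add_iff n₁]
  have hgeo := (summable_geometric_of_lt_one (by positivity) hsr).mul_left
    (max |u (n₁ + 1)| |u n₁| * r ^ n₁)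
  refine Summable.of_nonneg_of_le (fun n => by positivity) (fun j => ?_) hgeo
  have h1 : |u (j + n₁)| ≤ s ^ j * max |u (n₁ + 1)| |u n₁| := by
    rw [add_comm]; exact (le_max_right _ _).trans (hbound j)
  calc ‖u (j + n₁)‖ * r ^ (j + n₁)
      ≤ s ^ j * max |u (n₁ + 1)| |u n₁| * r ^ (j + n₁) :=
        mul_le_mul_of_nonneg_right h1 (by positivity)
    _ = _ := by rw [mul_pow, pow_add]; ring

/-- A solution of the recurrence is either minimal, or of constant sign from some index on with
at most polynomial decay. -/
theorem minimal_or_dominant (hC : 0 < C)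
    (h : ∀ n ≥ n₀, |u (n + 2) - u (n + 1)| ≤ C / (n + 2) * (|u (n + 1)| + |u n|)) :
    (∃ A B : ℝ, 0 < B ∧ ∀ n, |u n| ≤ A * (B ^ n / n.factorial)) ∨
    ∃ (σ : ℝ) (a m : ℕ), ∀ n ≥ m, 0 < σ * u n ∧
      (1 - (a : ℝ) / (n + 1)) * (σ * u n) ≤ σ * u (n + 1) := by
  -- Beyond this index 3C/(j+2) ≤ 1/2, which keeps consecutive ratios above 1/2 below.
  obtain ⟨k, hk⟩ := exists_nat_gt (6 * C)
  set n₁ := max n₀ k with hn₁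
  have hn₁k : ∀ n ≥ n₁, 6 * C ≤ n := fun n hn =>
    hk.le.trans (by exact_mod_cast le_trans (le_max_right _ _) hn)
  -- Either every ratio is O(1/n), which telescopes to a factorial bound, or a single ratio exceeds
  -- this threshold, and then the solution can never become minimal again.
  by_cases hcase : ∀ n ≥ n₁, |u (n + 1)| ≤ 4 * C / (n + 1) * |u n|
  · left
    have hB : 0 < 4 * C := by linarith
    have h1 : ∀ j : ℕ, |u (n₁ + j)| ≤ (|u n₁| * n₁.factorial / (4 * C) ^ n₁)
        * ((4 * C) ^ (n₁ + j) / (n₁ + j).factorial) := by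
      intro j
      induction j with
      | zero => simp only [add_zero]; field_simp; exact le_refl _
      | succ j ih =>
        refine (hcase (n₁ + j) (by omega)).trans ?_
        refine (mul_le_mul_of_nonneg_left ih (by positivity)).trans (le_of_eq ?_)
        rw [← add_assoc, Nat.factorial_succ, pow_succ]
        push_cast
        field_simp
    have h2 : u =O[Filter.atTop] fun n => (4 * C) ^ n / (n.factorial : ℝ) := by
      refine Asymptotics.IsBigO.of_bound (|u n₁| * n₁.factorial / (4 * C) ^ n₁) ?_
      filter_upwards [Filter.eventually_ge_atTop n₁] with n hn
      obtain ⟨j, rfl⟩ := Nat.exists_eq_add_of_le hn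
      rw [Real.norm_eq_abs, Real.norm_of_nonneg (by positivity)]
      exact h1 j
    rw [Asymptotics.isBigO_nat_atTop_iff fun n hn => absurd hn (by positivity)] at h2
    obtain ⟨A, hA⟩ := h2
    refine ⟨A, 4 * C, hB, fun n => ?_⟩
    have h3 := hA n
    rwa [Real.norm_eq_abs, Real.norm_of_nonneg (by positivity)] at h3
  · right
    push Not at hcase
    obtain ⟨n, hn, hlt⟩ := hcase
    obtain ⟨a, ha⟩ := exists_nat_gt (3 * C)
    have hne : u (n + 1) ≠ 0 := by
      intro h0
      rw [h0, abs_zero] at hlt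
      have : 0 ≤ 4 * C / (n + 1) * |u n| := by positivity
      linarith
    obtain ⟨σ, hσ, hσu⟩ : ∃ σ : ℝ, |σ| = 1 ∧ σ * u (n + 1) = |u (n + 1)| := by
      rcases le_total 0 (u (n + 1)) with h1 | h1
      · exact ⟨1, by simp, by rw [abs_of_nonneg h1, one_mul]⟩
      · exact ⟨-1, by simp, by rw [abs_of_nonpos h1]; ring⟩
    have hσabs : ∀ x : ℝ, |x| = |σ * x| := fun x => by rw [abs_mul, hσ, one_mul]
    set v : ℕ → ℝ := fun j => σ * u j with hv
    have hrec : ∀ j ≥ n₁, |v (j + 2) - v (j + 1)| ≤ C / (j + 2) * (|v (j + 1)| + |v j|) := by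
      intro j hj
      have h1 := h j (le_trans (le_max_left _ _) hj)
      rw [hσabs, hσabs (u (j + 1)), hσabs (u j), mul_sub] at h1
      exact h1
    have hv1 : 0 < v (n + 1) := by
      change 0 < σ * u (n + 1); rw [hσu]; exact abs_pos.mpr hne
    -- The bound |v j| ≤ 2 v (j+1) reproduces itself: it makes the increment at most 3C/(j+2) · v
    -- (j+1), hence at most half of v (j+1).
    have hstep : ∀ j ≥ n₁, 0 < v (j + 1) → |v j| ≤ 2 * v (j + 1) →
        (1 - 3 * C / (j + 2)) * v (j + 1) ≤ v (j + 2) ∧ v (j + 1) ≤ 2 * v (j + 2) := by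
      intro j hj h1 h2
      have h3 := hrec j hj
      have h4 : C / (j + 2) * (|v (j + 1)| + |v j|) ≤ C / (j + 2) * (3 * v (j + 1)) := by
        rw [abs_of_pos h1]; gcongr; linarith
      have h5 := neg_abs_le (v (j + 2) - v (j + 1))
      have h6 : C / (j + 2) * (3 * v (j + 1)) = 3 * C / (j + 2) * v (j + 1) := by ring
      have h7 : 3 * C / ((j : ℝ) + 2) ≤ 1 / 2 := by
        rw [div_le_iff₀ (by positivity)]
        have := hn₁k j hj
        linarith
      have h8 : (1 - 3 * C / (j + 2)) * v (j + 1) ≤ v (j + 2) := by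
        rw [h6] at h4; linarith
      refine ⟨h8, ?_⟩
      nlinarith
    -- The large ratio at n starts the induction: the two error terms take at most 1/6 and 1/4 of v
    -- (n+1), so more than half remains.
    have hfirst : 0 < v (n + 2) ∧ v (n + 1) ≤ 2 * v (n + 2) := by
      have h3 := hrec n hn
      have h1 : C / (n + 2) * |v n| ≤ 1 / 4 * v (n + 1) := by
        have h2 : 4 * C / (n + 1) * |v n| < v (n + 1) := by
          change 4 * C / (n + 1) * |σ * u n| < σ * u (n + 1)
          rw [hσu, ← hσabs]; exact hlt
        have h4 : C / ((n : ℝ) + 2) ≤ C / (n + 1) := by gcongr; linarith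
        have h5 := mul_le_mul_of_nonneg_right h4 (abs_nonneg (v n))
        have h6 : 4 * C / (n + 1) * |v n| = 4 * (C / (n + 1) * |v n|) := by ring
        linarith
      have h7 : C / ((n : ℝ) + 2) ≤ 1 / 6 := by
        rw [div_le_iff₀ (by positivity)]
        have := hn₁k n hn
        linarith
      have h8 := mul_le_mul_of_nonneg_right h7 hv1.le
      rw [abs_of_pos hv1, mul_add] at h3
      have h5 := neg_abs_le (v (n + 2) - v (n + 1))
      constructor <;> linarith
    have hind : ∀ j : ℕ, 0 < v (n + 1 + j) ∧ v (n + 1 + j) ≤ 2 * v (n + 1 + j + 1) := by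
      intro j
      induction j with
      | zero => exact ⟨hv1, hfirst.2⟩
      | succ j ih =>
        obtain ⟨h1, h2⟩ := ih
        have h3 : 0 < v (n + 1 + j + 1) := by linarith
        exact ⟨h3, (hstep (n + 1 + j) (by omega) h3 (by rwa [abs_of_pos h1])).2⟩
    refine ⟨σ, a, n + 2, fun j hj => ?_⟩
    obtain ⟨i, rfl⟩ := Nat.exists_eq_add_of_le hj
    have h1 := hind i
    have h2 := hind (i + 1)
    have e1 : n + 2 + i = n + 1 + (i + 1) := by ring
    rw [e1]
    refine ⟨h2.1, le_trans ?_ (hstep (n + 1 + i) (by omega) h2.1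
      (by rw [abs_of_pos h1.1]; exact h1.2)).1⟩
    change _ * v (n + 1 + (i + 1)) ≤ _ * v (n + 1 + (i + 1))
    refine mul_le_mul_of_nonneg_right ?_ h2.1.le
    have e2 : (((n + 1 + (i + 1) : ℕ) : ℝ) + 1) = ((n + 1 + i : ℕ) : ℝ) + 2 := by
      push_cast; ring
    rw [e2]
    have : 3 * C / (((n + 1 + i : ℕ) : ℝ) + 2) ≤ a / (((n + 1 + i : ℕ) : ℝ) + 2) := by gcongr
    linarith

/-- A power series with eventually nondecreasing positive multiples of the coefficients of some
derivative is not smooth up to `1`. -/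
theorem not_contDiffAt_one_of_dominant (hconv : ConvergesOn u 1) {σ : ℝ} {a m : ℕ}
    (h : ∀ n ≥ m, 0 < σ * u n ∧
      (1 - (a : ℝ) / (n + 1)) * (σ * u n) ≤ σ * u (n + 1))
    {f : ℝ → ℝ} (hf : ContDiffAt ℝ a f 1) (hfu : ∀ x ∈ Set.Ioo (0 : ℝ) 1, f x = powerSum u x) :
    False := by
  set d : ℕ → ℝ := fun n => σ * derivCoeff^[a] u n with hd
  -- Differentiating a times multiplies the ratio of consecutive coefficients by (n+a+1)/(n+1),
  -- exactly the inverse of the assumed lower bound 1 - a/(n+a+1).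
  have hmono : ∀ n ≥ m, d n ≤ d (n + 1) := by
    intro n hn
    have h1 := factorial_mul_derivCoeff_iterate u a n
    have h2 := factorial_mul_derivCoeff_iterate u a (n + 1)
    have h3 := (h (n + a) (by omega)).2
    rw [show n + 1 + a = n + a + 1 by ring, Nat.factorial_succ (n + a),
      Nat.factorial_succ n] at h2
    push_cast at h1 h2 h3
    have h4 : 1 - (a : ℝ) / (n + a + 1) = (n + 1) / (n + a + 1) := by
      field_simp; ring
    rw [h4, div_mul_eq_mul_div, div_le_iff₀ (by positivity)] at h3
    have h5 : (0 : ℝ) < ((n + a).factorial : ℝ) := by positivity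
    have h6 := mul_le_mul_of_nonneg_left h3 h5.le
    have h7 : (0 : ℝ) < (n + 1) * (n.factorial : ℝ) := by positivity
    refine le_of_mul_le_mul_left ?_ h7
    simp only [hd]
    calc ((n : ℝ) + 1) * n.factorial * (σ * derivCoeff^[a] u n)
        = (n + 1) * σ * (n.factorial * derivCoeff^[a] u n) := by ring
      _ = (n + a).factorial * ((n + 1) * (σ * u (n + a))) := by rw [h1]; ring
      _ ≤ _ := h6
      _ = σ * ((n + a + 1) * (n + a).factorial * u (n + a + 1)) := by ring
      _ = _ := by rw [← h2]; ring
  have hpos : 0 < d m := by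
    have h1 := factorial_mul_derivCoeff_iterate u a m
    have h2 := (h (m + a) (by omega)).1
    have h5 : (0 : ℝ) < ((m + a).factorial : ℝ) := by positivity
    have h7 : (0 : ℝ) < (m.factorial : ℝ) := by positivity
    have h8 : (m.factorial : ℝ) * d m = (m + a).factorial * (σ * u (m + a)) := by
      simp only [hd]; linear_combination σ * h1
    by_contra hneg
    push Not at hneg
    nlinarith [mul_pos h5 h2, mul_nonneg h7.le (neg_nonneg.mpr hneg)]
  have hge : ∀ j : ℕ, d m ≤ d (m + j) := by
    intro j
    induction j with
    | zero => exact le_refl _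
    | succ j ih => exact ih.trans (hmono (m + j) (by omega))
  -- the derivative is bounded near `1`
  have hcont : ContinuousAt (iteratedDeriv a f) 1 := continuousAt_iteratedDeriv hf
  have hD : ∀ x ∈ Set.Ioo (0 : ℝ) 1, iteratedDeriv a f x = powerSum (derivCoeff^[a] u) x := by
    intro x hx
    rw [← hconv.iteratedDeriv_eq a (by rw [Real.norm_of_nonneg hx.1.le]; exact hx.2)]
    refine Filter.EventuallyEq.iteratedDeriv_eq a ?_
    filter_upwards [isOpen_Ioo.mem_nhds hx] with y hy using hfu y hy
  -- Only terms of index at least m are dropped, since earlier ones may be negative.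
  have hpart : ∀ j : ℕ, ∀ x ∈ Set.Ioo (0 : ℝ) 1,
      ∑ i ∈ Finset.range (m + j), d i * x ^ i ≤ σ * iteratedDeriv a f x := by
    intro j x hx
    have hs := (hconv.derivCoeff_iterate a).hasSum
      (show ‖x‖ < 1 by rw [Real.norm_of_nonneg hx.1.le]; exact hx.2)
    rw [hD x hx]
    have hs' : HasSum (fun i => d i * x ^ i) (σ * powerSum (derivCoeff^[a] u) x) := by
      simpa only [hd, mul_assoc] using hs.mul_left σ
    refine sum_le_hasSum _ (fun i hi => ?_) hs'
    have hi' : m ≤ i := by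
      rw [Finset.mem_range] at hi; omega
    obtain ⟨l, rfl⟩ := Nat.exists_eq_add_of_le hi'
    exact mul_nonneg (hpos.le.trans (hge l)) (pow_nonneg hx.1.le _)
  have hlim : ∀ j : ℕ, ∑ i ∈ Finset.range (m + j), d i ≤ σ * iteratedDeriv a f 1 := by
    intro j
    have h1 : Filter.Tendsto (fun x : ℝ => ∑ i ∈ Finset.range (m + j), d i * x ^ i)
        (nhdsWithin 1 (Set.Iio 1)) (nhds (∑ i ∈ Finset.range (m + j), d i * 1 ^ i)) :=
      (Continuous.tendsto (by fun_prop) 1).mono_left nhdsWithin_le_nhds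
    have h2 : Filter.Tendsto (fun x : ℝ => σ * iteratedDeriv a f x)
        (nhdsWithin 1 (Set.Iio 1)) (nhds (σ * iteratedDeriv a f 1)) :=
      (hcont.tendsto.const_mul σ).mono_left nhdsWithin_le_nhds
    simp only [one_pow, mul_one] at h1
    refine le_of_tendsto_of_tendsto h1 h2 ?_
    filter_upwards [Ioo_mem_nhdsLT (show (0 : ℝ) < 1 by norm_num)] with x hx using hpart j x hx
  -- The partial sums at 1 are bounded by the a-th derivative there, yet each further term adds at
  -- least d m > 0.
  obtain ⟨j, hj⟩ := exists_nat_gt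
    ((σ * iteratedDeriv a f 1 - ∑ i ∈ Finset.range m, d i) / d m)
  rw [div_lt_iff₀ hpos] at hj
  have h1 := hlim j
  rw [Finset.sum_range_add] at h1
  have h2 : ∑ _i ∈ Finset.range j, d m ≤ ∑ i ∈ Finset.range j, d (m + i) :=
    Finset.sum_le_sum fun i _ => hge i
  rw [Finset.sum_const, Finset.card_range, nsmul_eq_mul] at h2
  linarith

end Recurrence

/-! ### The first-order system and its coefficient recursion. -/

section System

variable {𝕜 : Type*} [RCLike 𝕜]

/-- The system `x u' = N u - Δ v`, `(x - 1) v' = (c (x - 1) + N) v - Δ u` at the point `x`. -/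
def SolvesAt (N : ℕ) (c Δ : 𝕜) (u v : 𝕜 → 𝕜) (x : 𝕜) : Prop :=
  ∃ u' v' : 𝕜, HasDerivAt u u' x ∧ HasDerivAt v v' x ∧ x * u' = N * u x - Δ * v x ∧
    (x - 1) * v' = (c * (x - 1) + N) * v x - Δ * u x

/-- The recursion for the power series coefficients of a solution `(∑ b_n xⁿ, ∑ a_n xⁿ)`. -/
def CoeffSystem (N : ℕ) (c Δ : 𝕜) (b a : ℕ → 𝕜) : Prop :=
  ∀ n : ℕ, ((n : 𝕜) - N) * b n = -(Δ * a n) ∧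
    n * a n - derivCoeff a n = c * shiftCoeff a n + (N - c) * a n - Δ * b n

variable {N : ℕ} {c Δ : 𝕜} {b a : ℕ → 𝕜} {R : ℝ} {x : 𝕜}

theorem hasSum_first_equation (hb : ConvergesOn b R) (ha : ConvergesOn a R) (hx : ‖x‖ < R) :
    HasSum (fun n : ℕ => (((n : 𝕜) - N) * b n + Δ * a n) * x ^ n)
      (x * powerSum (derivCoeff b) x - N * powerSum b x + Δ * powerSum a x) := by
  have h := ((hb.hasSum_natCast_mul hx).sub ((hb.hasSum hx).mul_left (N : 𝕜))).add
    ((ha.hasSum hx).mul_left Δ)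
  refine h.congr_fun fun n => ?_
  ring

theorem hasSum_second_equation (hb : ConvergesOn b R) (ha : ConvergesOn a R) (hx : ‖x‖ < R) :
    HasSum (fun n : ℕ => (n * a n - derivCoeff a n
        - (c * shiftCoeff a n + (N - c) * a n - Δ * b n)) * x ^ n)
      ((x - 1) * powerSum (derivCoeff a) x
        - ((c * (x - 1) + N) * powerSum a x - Δ * powerSum b x)) := by
  have h := ((ha.hasSum_natCast_mul hx).sub (ha.derivCoeff.hasSum hx)).sub
    ((((ha.hasSum_shiftCoeff hx).mul_left c).add ((ha.hasSum hx).mul_left (N - c))).sub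
      ((hb.hasSum hx).mul_left Δ))
  have e : (x - 1) * powerSum (derivCoeff a) x
      - ((c * (x - 1) + N) * powerSum a x - Δ * powerSum b x)
      = x * powerSum (derivCoeff a) x - powerSum (derivCoeff a) x
        - (c * (x * powerSum a x) + (N - c) * powerSum a x - Δ * powerSum b x) := by ring
  rw [e]
  refine h.congr_fun fun n => ?_
  ring

/-- The coefficient recursion makes every term of the power series of the two residuals vanish. -/
theorem CoeffSystem.solvesAt (h : CoeffSystem N c Δ b a) (hb : ConvergesOn b R)
    (ha : ConvergesOn a R) (hx : ‖x‖ < R) : SolvesAt N c Δ (powerSum b) (powerSum a) x := by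
  refine ⟨_, _, hb.hasDerivAt hx, ha.hasDerivAt hx, ?_, ?_⟩
  · have h1 := hasSum_first_equation (N := N) (Δ := Δ) hb ha hx
    have h2 : ∀ n : ℕ, (((n : 𝕜) - N) * b n + Δ * a n) * x ^ n = 0 := fun n => by
      rw [(h n).1]; ring
    simp only [h2] at h1
    linear_combination h1.unique hasSum_zero
  · have h1 := hasSum_second_equation (N := N) (Δ := Δ) (c := c) hb ha hx
    have h2 : ∀ n : ℕ, (n * a n - derivCoeff a n
        - (c * shiftCoeff a n + (N - c) * a n - Δ * b n)) * x ^ n = 0 := fun n => by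
      rw [(h n).2]; ring
    simp only [h2] at h1
    linear_combination h1.unique hasSum_zero

theorem SolvesAt.add {u v u₁ v₁ : 𝕜 → 𝕜} (h : SolvesAt N c Δ u v x)
    (h₁ : SolvesAt N c Δ u₁ v₁ x) :
    SolvesAt N c Δ (fun y => u y + u₁ y) (fun y => v y + v₁ y) x := by
  obtain ⟨u', v', h1, h2, h3, h4⟩ := h
  obtain ⟨u₁', v₁', h5, h6, h7, h8⟩ := h₁
  refine ⟨_, _, h1.add h5, h2.add h6, ?_, ?_⟩
  · linear_combination h3 + h7
  · linear_combination h4 + h8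

theorem SolvesAt.const_mul {u v : 𝕜 → 𝕜} (k : 𝕜) (h : SolvesAt N c Δ u v x) :
    SolvesAt N c Δ (fun y => k * u y) (fun y => k * v y) x := by
  obtain ⟨u', v', h1, h2, h3, h4⟩ := h
  refine ⟨_, _, h1.const_mul k, h2.const_mul k, ?_, ?_⟩
  · linear_combination k * h3
  · linear_combination k * h4

end System

theorem convergesOn_of_summable {a : ℕ → ℂ} {R : ℝ}
    (h : ∀ x : ℂ, ‖x‖ < R → Summable fun n => a n * x ^ n) : ConvergesOn a R := by
  intro r h0 hr
  have h1 := (h (r : ℂ) (by rwa [Complex.norm_real, Real.norm_of_nonneg h0])).norm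
  simpa [norm_mul, norm_pow, abs_of_nonneg h0] using h1

/-- If power series solve the system near `0` then their coefficients satisfy the recursion. -/
theorem CoeffSystem.of_solvesAt {N : ℕ} {c Δ : ℂ} {b a : ℕ → ℂ} {R : ℝ}
    (hb : ConvergesOn b R) (ha : ConvergesOn a R) (hR : 0 < R)
    (h : ∀ x : ℂ, ‖x‖ < R → SolvesAt N c Δ (powerSum b) (powerSum a) x) :
    CoeffSystem N c Δ b a := by
  have h1 : ∀ x : ℂ, ‖x‖ < R → HasSum (fun n : ℕ => (((n : ℂ) - N) * b n + Δ * a n) * x ^ n) 0 := by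
    intro x hx
    obtain ⟨u', v', hu, hv, e1, e2⟩ := h x hx
    have h2 := hasSum_first_equation (N := N) (Δ := Δ) hb ha hx
    rw [hu.unique (hb.hasDerivAt hx)] at e1
    rwa [e1, sub_right_comm, sub_self, zero_sub, neg_add_cancel] at h2
  have h2 : ∀ x : ℂ, ‖x‖ < R → HasSum (fun n : ℕ => (n * a n - derivCoeff a n
        - (c * shiftCoeff a n + (N - c) * a n - Δ * b n)) * x ^ n) 0 := by
    intro x hx
    obtain ⟨u', v', hu, hv, e1, e2⟩ := h x hx
    have h2 := hasSum_second_equation (N := N) (Δ := Δ) (c := c) hb ha hx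
    rw [hv.unique (ha.hasDerivAt hx)] at e2
    rwa [e2, sub_self] at h2
  intro n
  have h3 := coeff_eq_zero_of_powerSum_eq_zero
    (convergesOn_of_summable fun x hx => (h1 x hx).summable) hR (fun x hx => (h1 x hx).tsum_eq) n
  have h4 := coeff_eq_zero_of_powerSum_eq_zero
    (convergesOn_of_summable fun x hx => (h2 x hx).summable) hR (fun x hx => (h2 x hx).tsum_eq) n
  exact ⟨eq_neg_of_add_eq_zero_left h3, sub_eq_zero.mp h4⟩

/-! ### Parity and uniqueness on the interval (0, 1). -/

section RealSystem

variable {N : ℕ} {c Δ : ℝ}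

/-- The parity symmetry of the system. -/
theorem SolvesAt.reflect {u v : ℝ → ℝ} {x : ℝ} (h : SolvesAt N c Δ u v (1 - x)) :
    SolvesAt N c Δ (fun y => Real.exp (c * y - c / 2) * v (1 - y))
      (fun y => Real.exp (c * y - c / 2) * u (1 - y)) x := by
  obtain ⟨u', v', h1, h2, h3, h4⟩ := h
  have he : HasDerivAt (fun y => Real.exp (c * y - c / 2)) (Real.exp (c * x - c / 2) * c) x := by
    have h5 : HasDerivAt (fun y => c * y - c / 2) c x := by
      simpa using ((hasDerivAt_id x).const_mul c).sub_const (c / 2)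
    exact h5.exp
  have hs : HasDerivAt (fun y : ℝ => 1 - y) (-1) x := by
    simpa using (hasDerivAt_id x).const_sub 1
  have h6 : HasDerivAt (fun y => u (1 - y)) (u' * -1) x := h1.comp x hs
  have h7 : HasDerivAt (fun y => v (1 - y)) (v' * -1) x := h2.comp x hs
  refine ⟨_, _, he.mul h7, he.mul h6, ?_, ?_⟩
  · linear_combination Real.exp (c * x - c / 2) * h4
  · linear_combination Real.exp (c * x - c / 2) * h3

/-- Solutions on `(0, 1)` are determined by their values at `1/2`. -/
theorem eq_zero_of_solvesAt {u v : ℝ → ℝ} (h : ∀ x ∈ Set.Ioo (0 : ℝ) 1, SolvesAt N c Δ u v x)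
    (hu : u (1 / 2) = 0) (hv : v (1 / 2) = 0) {x : ℝ} (hx : x ∈ Set.Ioo (0 : ℝ) 1) :
    u x = 0 ∧ v x = 0 := by
  -- Both 1/2 and x lie in (δ, 1-δ), where 1/t and 1/(1-t) are bounded by 1/δ, so the vector field
  -- is uniformly Lipschitz.
  obtain ⟨δ, hδ0, hδ⟩ : ∃ δ : ℝ, 0 < δ ∧ δ < min (1 / 2) (min x (1 - x)) :=
    exists_between (lt_min (by norm_num) (lt_min hx.1 (by linarith [hx.2])))
  rw [lt_min_iff, lt_min_iff] at hδ
  obtain ⟨hδ1, hδ2, hδ3⟩ := hδ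
  set w : ℝ → ℝ × ℝ → ℝ × ℝ := fun t p =>
    ((N * p.1 - Δ * p.2) / t, ((c * (t - 1) + N) * p.2 - Δ * p.1) / (t - 1)) with hw
  set K : ℝ := (N + |Δ| + |c|) / δ with hK
  have hK0 : 0 ≤ K := by positivity
  have hlip : ∀ t ∈ Set.Ioo δ (1 - δ), LipschitzOnWith K.toNNReal (w t) Set.univ := by
    intro t ht
    refine LipschitzOnWith.of_dist_le_mul fun p _ q _ => ?_
    rw [Real.coe_toNNReal K hK0]
    have h1 : |p.1 - q.1| ≤ dist p q := by
      rw [Prod.dist_eq, Real.dist_eq]; exact le_max_left _ _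
    have h2 : |p.2 - q.2| ≤ dist p q := by
      rw [Prod.dist_eq, Real.dist_eq, Real.dist_eq]; exact le_max_right _ _
    have hd : 0 ≤ dist p q := dist_nonneg
    have hN : (0 : ℝ) ≤ N := Nat.cast_nonneg N
    have htpos : 0 < t := hδ0.trans ht.1
    have ht1 : 0 < 1 - t := by linarith [ht.2]
    rw [Prod.dist_eq (x := w t p)]
    refine max_le ?_ ?_
    · have e : (w t p).1 - (w t q).1 = (N * (p.1 - q.1) - Δ * (p.2 - q.2)) / t := by
        simp only [hw]; ring
      rw [Real.dist_eq, e, abs_div, abs_of_pos htpos, hK, div_mul_eq_mul_div]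
      refine div_le_div₀ (by positivity) ?_ hδ0 ht.1.le
      calc |(N : ℝ) * (p.1 - q.1) - Δ * (p.2 - q.2)|
          ≤ |(N : ℝ) * (p.1 - q.1)| + |Δ * (p.2 - q.2)| := abs_sub _ _
        _ = N * |p.1 - q.1| + |Δ| * |p.2 - q.2| := by
            rw [abs_mul, abs_mul, abs_of_nonneg hN]
        _ ≤ N * dist p q + |Δ| * dist p q := by gcongr
        _ ≤ (N + |Δ| + |c|) * dist p q := by nlinarith [mul_nonneg (abs_nonneg c) hd]
    · have e : (w t p).2 - (w t q).2
          = ((c * (t - 1) + N) * (p.2 - q.2) - Δ * (p.1 - q.1)) / (t - 1) := by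
        simp only [hw]; ring
      have h3 : |t - 1| = 1 - t := by rw [abs_sub_comm, abs_of_pos ht1]
      have h4 : |c * (t - 1) + N| ≤ |c| + N := by
        refine (abs_add_le _ _).trans ?_
        rw [abs_mul, h3, abs_of_nonneg hN]
        have : |c| * (1 - t) ≤ |c| * 1 := by gcongr; linarith
        linarith
      rw [Real.dist_eq, e, abs_div, h3, hK, div_mul_eq_mul_div]
      refine div_le_div₀ (by positivity) ?_ hδ0 (by linarith [ht.2])
      calc |(c * (t - 1) + N) * (p.2 - q.2) - Δ * (p.1 - q.1)|
          ≤ |(c * (t - 1) + N) * (p.2 - q.2)| + |Δ * (p.1 - q.1)| := abs_sub _ _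
        _ = |c * (t - 1) + N| * |p.2 - q.2| + |Δ| * |p.1 - q.1| := by rw [abs_mul, abs_mul]
        _ ≤ (|c| + N) * dist p q + |Δ| * dist p q := by gcongr
        _ = (N + |Δ| + |c|) * dist p q := by ring
  have hsub : ∀ t ∈ Set.Ioo δ (1 - δ), t ∈ Set.Ioo (0 : ℝ) 1 := fun t ht =>
    ⟨hδ0.trans ht.1, by linarith [ht.2]⟩
  have key := ODE_solution_unique_of_mem_Ioo (v := w) (s := fun _ => Set.univ)
    (f := fun t => (u t, v t)) (g := fun _ => (0, 0)) (t₀ := 1 / 2) (K := K.toNNReal)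
    (a := δ) (b := 1 - δ) hlip ⟨hδ1, by linarith⟩ (fun t ht => ⟨?_, trivial⟩)
    (fun t ht => ⟨?_, trivial⟩) (by rw [hu, hv])
  · have h1 := key (show x ∈ Set.Ioo δ (1 - δ) from ⟨hδ2, by linarith⟩)
    simpa using h1
  · obtain ⟨u', v', h1, h2, h3, h4⟩ := h t (hsub t ht)
    have ht0 : t ≠ 0 := (hsub t ht).1.ne'
    have ht1 : t - 1 ≠ 0 := by linarith [(hsub t ht).2]
    have e1 : u' = (N * u t - Δ * v t) / t := by rw [eq_div_iff ht0, ← h3]; ring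
    have e2 : v' = ((c * (t - 1) + N) * v t - Δ * u t) / (t - 1) := by
      rw [eq_div_iff ht1, ← h4]; ring
    have h5 := h1.prodMk h2
    rw [e1, e2] at h5
    exact h5
  · have e : w t (0, 0) = 0 := by simp [hw]
    rw [e]
    exact hasDerivAt_const t _

theorem eq_of_solvesAt {u v u₁ v₁ : ℝ → ℝ}
    (h : ∀ x ∈ Set.Ioo (0 : ℝ) 1, SolvesAt N c Δ u v x)
    (h₁ : ∀ x ∈ Set.Ioo (0 : ℝ) 1, SolvesAt N c Δ u₁ v₁ x)
    (hu : u (1 / 2) = u₁ (1 / 2)) (hv : v (1 / 2) = v₁ (1 / 2)) {x : ℝ}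
    (hx : x ∈ Set.Ioo (0 : ℝ) 1) : u x = u₁ x ∧ v x = v₁ x := by
  have h2 := eq_zero_of_solvesAt (fun y hy => (h y hy).add ((h₁ y hy).const_mul (-1)))
    (by rw [hu]; ring) (by rw [hv]; ring) hx
  exact ⟨by linarith [h2.1], by linarith [h2.2]⟩

end RealSystem

/-! ### The solution φ_1 and the meaning of the G-functions. -/

section Coefficients

variable {N : ℕ} {g Δ : ℝ}

/-- The coefficients of `φ_{1,+}`. -/
def coeffPlus (N : ℕ) (g Δ : ℝ) (n : ℕ) : ℝ :=
  if n = N then ((N : ℝ) + 1) / Δ else -(Δ * coeffK N g Δ n / ((n : ℝ) - N))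

theorem coeffPlus_self (N : ℕ) (g Δ : ℝ) : coeffPlus N g Δ N = ((N : ℝ) + 1) / Δ := by
  simp [coeffPlus]

theorem coeffPlus_of_lt {n : ℕ} (h : n < N) : coeffPlus N g Δ n = 0 := by
  simp [coeffPlus, h.ne, coeffK_of_le g Δ h.le]

theorem coeffPlus_add (N : ℕ) (g Δ : ℝ) (k : ℕ) :
    coeffPlus N g Δ (N + 1 + k) = -(Δ * (coeffK N g Δ (N + 1 + k) / ((k : ℝ) + 1))) := by
  rw [coeffPlus, if_neg (by omega)]
  push_cast
  rw [show (N : ℝ) + 1 + k - N = k + 1 by ring, mul_div_assoc]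

/-- At n = N the first equation leaves b_N free because a_N = 0. The second, with a_{N+1} = 1,
forces b_N = (N+1)/Δ. -/
theorem coeffSystem_coeffK (hΔ : Δ ≠ 0) :
    CoeffSystem N (4 * g ^ 2) Δ (coeffPlus N g Δ) (coeffK N g Δ) := by
  intro n
  rcases lt_trichotomy n N with h | h | h
  · have h1 := coeffK_of_le g Δ h.le
    have h2 : coeffK N g Δ (n + 1) = 0 := coeffK_of_le g Δ h
    have h3 : shiftCoeff (coeffK N g Δ) n = 0 := by
      rcases n with _ | n
      · rfl
      · exact coeffK_of_le g Δ (by omega)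
    simp [h1, h2, h3, coeffPlus_of_lt h, derivCoeff]
  · subst h
    have h1 := coeffK_of_le g Δ (le_refl n)
    have h3 : shiftCoeff (coeffK n g Δ) n = 0 := by
      rcases n with _ | n
      · rfl
      · exact coeffK_of_le g Δ (by omega)
    simp only [h1, h3, coeffPlus_self, derivCoeff, coeffK_init]
    refine ⟨by simp, ?_⟩
    field_simp
    ring
  · obtain ⟨m, rfl⟩ : ∃ m, n = m + 1 := ⟨n - 1, by omega⟩
    have h0 := coeffK_succ g Δ h
    have hne : ((m + 1 : ℕ) : ℝ) - N ≠ 0 := by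
      rw [sub_ne_zero]; exact_mod_cast h.ne'
    rw [Nat.add_sub_cancel] at h0
    rw [coeffPlus, if_neg h.ne']
    refine ⟨by field_simp, ?_⟩
    simp only [derivCoeff, shiftCoeff]
    rw [h0]
    have e : Δ ^ 2 / ((N : ℝ) - ((m + 1 : ℕ) : ℝ)) = -(Δ ^ 2 / (((m + 1 : ℕ) : ℝ) - N)) := by
      rw [← div_neg, neg_sub]
    rw [e]
    ring

/-- The form needed for the dichotomy. For n ≥ N the denominator N - (n+1) has absolute value at
least 1, so the Δ² term is bounded by Δ². -/
theorem abs_coeffK_sub_le (N : ℕ) (g Δ : ℝ) : ∀ n ≥ N,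
    |coeffK N g Δ (n + 2) - coeffK N g Δ (n + 1)| ≤ (4 * g ^ 2 + 1 + N + Δ ^ 2) / (n + 2)
      * (|coeffK N g Δ (n + 1)| + |coeffK N g Δ n|) := by
  intro n hn
  have h0 := coeffK_succ g Δ (show N < n + 1 by omega)
  rw [Nat.add_sub_cancel] at h0
  push_cast at h0
  set K := coeffK N g Δ
  have hnN : (N : ℝ) ≤ n := by exact_mod_cast hn
  set y := Δ ^ 2 / ((N : ℝ) - (n + 1)) with hy
  have hy1 : |y| ≤ Δ ^ 2 := by
    rw [hy, abs_div, abs_of_nonneg (sq_nonneg Δ), abs_of_neg (by linarith)]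
    exact div_le_self (sq_nonneg Δ) (by linarith)
  have h2 : ((n : ℝ) + 2) * (K (n + 2) - K (n + 1))
      = (4 * g ^ 2 - 1 - N + y) * K (n + 1) - 4 * g ^ 2 * K n := by
    linear_combination h0
  have hc : |4 * g ^ 2 - 1 - N + y| ≤ 4 * g ^ 2 + 1 + N + Δ ^ 2 := by
    have := abs_le.mp hy1
    rw [abs_le]
    constructor <;> nlinarith [sq_nonneg g, (Nat.cast_nonneg N : (0 : ℝ) ≤ N)]
  have hc2 : |4 * g ^ 2| ≤ 4 * g ^ 2 + 1 + N + Δ ^ 2 := by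
    rw [abs_of_nonneg (by positivity)]
    nlinarith [sq_nonneg Δ, (Nat.cast_nonneg N : (0 : ℝ) ≤ N)]
  rw [div_mul_eq_mul_div, le_div_iff₀ (by positivity)]
  calc |K (n + 2) - K (n + 1)| * (n + 2) = |((n : ℝ) + 2) * (K (n + 2) - K (n + 1))| := by
        rw [abs_mul, abs_of_nonneg (show (0 : ℝ) ≤ n + 2 by positivity), mul_comm]
    _ ≤ |4 * g ^ 2 - 1 - N + y| * |K (n + 1)| + |4 * g ^ 2| * |K n| := by
        rw [h2, ← abs_mul, ← abs_mul]; exact abs_sub _ _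
    _ ≤ (4 * g ^ 2 + 1 + N + Δ ^ 2) * |K (n + 1)| + (4 * g ^ 2 + 1 + N + Δ ^ 2) * |K n| := by
        gcongr
    _ = _ := by ring

theorem convergesOn_coeffK (N : ℕ) (g Δ : ℝ) : ConvergesOn (coeffK N g Δ) 1 :=
  convergesOn_one_of_recurrence (by positivity) (abs_coeffK_sub_le N g Δ)

theorem abs_coeffPlus_le {n : ℕ} (h : n ≠ N) :
    |coeffPlus N g Δ n| ≤ |Δ| * |coeffK N g Δ n| := by
  rw [coeffPlus, if_neg h, abs_neg, abs_div, abs_mul]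
  refine div_le_self (by positivity) ?_
  have h1 : (1 : ℤ) ≤ |(n : ℤ) - N| := Int.one_le_abs (sub_ne_zero.mpr (by exact_mod_cast h))
  exact_mod_cast h1

theorem ConvergesOn.coeffPlus {R : ℝ} (h : ConvergesOn (coeffK N g Δ) R) :
    ConvergesOn (coeffPlus N g Δ) R := by
  intro r h0 hr
  rw [← summable_nat_add_iff (N + 1)]
  refine Summable.of_nonneg_of_le (fun n => by positivity) (fun n => ?_)
    (((summable_nat_add_iff (N + 1)).mpr (h r h0 hr)).mul_left |Δ|)
  rw [← mul_assoc]
  exact mul_le_mul_of_nonneg_right (abs_coeffPlus_le (by omega)) (by positivity)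

/-- The point x = 1/2 corresponds to z = 0 and is fixed by parity, so G_+ measures how far φ_1 is
from being parity-even. -/
theorem GPlus_eq (N : ℕ) (g Δ : ℝ) : GPlus N g Δ = 2 ^ (N + 1)
    * (powerSum (coeffK N g Δ) (1 / 2) - powerSum (coeffPlus N g Δ) (1 / 2)) := by
  have hK := convergesOn_coeffK N g Δ
  have hx : ‖(1 / 2 : ℝ)‖ < 1 := by norm_num
  have h1 := (hK.hasSum hx).sub (hK.coeffPlus.hasSum hx)
  have h2 := ((hasSum_nat_add_iff' (N + 1)).mpr h1).mul_left (2 ^ (N + 1))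
  have h3 : ∑ i ∈ Finset.range (N + 1), (coeffK N g Δ i * (1 / 2) ^ i
      - coeffPlus N g Δ i * (1 / 2) ^ i) = -(((N : ℝ) + 1) / Δ * (1 / 2) ^ N) := by
    rw [Finset.sum_range_succ, Finset.sum_eq_zero]
    · rw [coeffPlus_self, coeffK_of_le g Δ (le_refl N)]; ring
    · intro i hi
      have hi' := Finset.mem_range.mp hi
      rw [coeffPlus_of_lt hi', coeffK_of_le g Δ hi'.le]; ring
  rw [h3] at h2
  have h4 : HasSum (fun k : ℕ => coeffK N g Δ (N + 1 + k) * (1 + Δ / ((k : ℝ) + 1))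
      * (1 / 2) ^ k) _ := h2.congr_fun fun k => by
    rw [add_comm k, coeffPlus_add, pow_add]
    have : (2 : ℝ) ^ (N + 1) * (1 / 2) ^ (N + 1) = 1 := by rw [← mul_pow]; norm_num
    linear_combination (-(coeffK N g Δ (N + 1 + k) * (1 + Δ / ((k : ℝ) + 1))
      * (1 / 2) ^ k)) * this
  rw [GPlus, h4.tsum_eq]
  have : (2 : ℝ) ^ N * (1 / 2) ^ N = 1 := by rw [← mul_pow]; norm_num
  rw [pow_succ]
  linear_combination (2 * ((N : ℝ) + 1) / Δ) * this

theorem coeffK_neg (N : ℕ) (g Δ : ℝ) : coeffK N g (-Δ) = coeffK N g Δ := by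
  funext n
  induction n using Nat.strong_induction_on with
  | _ n ih =>
    match n with
    | 0 => rfl
    | 1 => rfl
    | n + 2 => rw [coeffK, coeffK, ih (n + 1) (by omega), ih n (by omega), neg_sq]

theorem coeffPlus_neg (N : ℕ) (g Δ : ℝ) (n : ℕ) :
    coeffPlus N g (-Δ) n = -coeffPlus N g Δ n := by
  rw [coeffPlus, coeffPlus, coeffK_neg]
  split_ifs
  · rw [div_neg]
  · ring

/-- The vanishing of `G_±` as a condition at the fixed point `1/2` of the parity. -/
theorem exists_sign_of_G_eq_zero (hG : GPlus N g Δ = 0 ∨ GMinus N g Δ = 0) :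
    ∃ ε : ℝ, ε * ε = 1 ∧
      powerSum (coeffK N g Δ) (1 / 2) = ε * powerSum (coeffPlus N g Δ) (1 / 2) := by
  rcases hG with h | h
  · refine ⟨1, by ring, ?_⟩
    rw [GPlus_eq, mul_eq_zero] at h
    have := h.resolve_left (by positivity)
    linarith
  · refine ⟨-1, by ring, ?_⟩
    rw [GMinus, GPlus_eq, mul_eq_zero, coeffK_neg] at h
    have h1 := h.resolve_left (by positivity)
    have h2 : powerSum (coeffPlus N g (-Δ)) (1 / 2) = -powerSum (coeffPlus N g Δ) (1 / 2) := by
      rw [powerSum, powerSum, ← tsum_neg]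
      refine tsum_congr fun n => ?_
      rw [coeffPlus_neg]; ring
    linarith

theorem solvesAt_coeff (hΔ : Δ ≠ 0) : ∀ x ∈ Set.Ioo (0 : ℝ) 1,
    SolvesAt N (4 * g ^ 2) Δ (powerSum (coeffPlus N g Δ)) (powerSum (coeffK N g Δ)) x := by
  intro x hx
  have hK := convergesOn_coeffK N g Δ
  exact (coeffSystem_coeffK hΔ).solvesAt hK.coeffPlus hK
    (by rw [Real.norm_of_nonneg hx.1.le]; exact hx.2)

theorem reflect_mem {x : ℝ} (hx : x ∈ Set.Ioo (0 : ℝ) 1) : 1 - x ∈ Set.Ioo (0 : ℝ) 1 :=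
  ⟨by linarith [hx.2], by linarith [hx.1]⟩

/-- If `G_±` vanishes then `φ_1` is an eigenfunction of the parity. -/
theorem parity_eigen (hΔ : Δ ≠ 0) {ε : ℝ} (hε : ε * ε = 1)
    (h : powerSum (coeffK N g Δ) (1 / 2) = ε * powerSum (coeffPlus N g Δ) (1 / 2))
    {x : ℝ} (hx : x ∈ Set.Ioo (0 : ℝ) 1) :
    powerSum (coeffPlus N g Δ) x = ε * (Real.exp (4 * g ^ 2 * x - 4 * g ^ 2 / 2)
        * powerSum (coeffK N g Δ) (1 - x)) ∧
    powerSum (coeffK N g Δ) x = ε * (Real.exp (4 * g ^ 2 * x - 4 * g ^ 2 / 2)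
        * powerSum (coeffPlus N g Δ) (1 - x)) := by
  have h1 : ((1 : ℝ) - 1 / 2) = 1 / 2 := by norm_num
  have h2 : (4 * g ^ 2 * (1 / 2) - 4 * g ^ 2 / 2 : ℝ) = 0 := by ring
  refine eq_of_solvesAt (solvesAt_coeff hΔ)
    (fun y hy => (solvesAt_coeff hΔ (1 - y) (reflect_mem hy)).reflect.const_mul ε) ?_ ?_ hx
  · simp only [h1, h2, Real.exp_zero, one_mul]
    rw [h, ← mul_assoc, hε, one_mul]
  · simp only [h1, h2, Real.exp_zero, one_mul]
    exact h

/-- If `G_±` vanishes then `K_n` is the minimal solution of its recursion. -/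
theorem exists_coeffK_bound (hΔ : Δ ≠ 0) (hG : GPlus N g Δ = 0 ∨ GMinus N g Δ = 0) :
    ∃ A B : ℝ, 0 < B ∧ ∀ n, |coeffK N g Δ n| ≤ A * (B ^ n / n.factorial) := by
  obtain ⟨ε, hε, h⟩ := exists_sign_of_G_eq_zero hG
  rcases minimal_or_dominant (by positivity) (abs_coeffK_sub_le N g Δ) with h1 | ⟨σ, a, m, h1⟩
  · exact h1
  · exfalso
    have hK := convergesOn_coeffK N g Δ
    -- The reflected formula extends φ_{1,-} smoothly across 1, because φ_{1,+} is analytic at 0.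
    refine not_contDiffAt_one_of_dominant hK h1
      (f := fun x => ε * (Real.exp (4 * g ^ 2 * x - 4 * g ^ 2 / 2)
        * powerSum (coeffPlus N g Δ) (1 - x))) ?_
      (fun x hx => ((parity_eigen hΔ hε h hx).2).symm)
    have h2 : ContDiffAt ℝ a (powerSum (coeffPlus N g Δ)) (1 - 1) :=
      hK.coeffPlus.contDiffAt a (by simp)
    have h3 : ContDiffAt ℝ a (fun x : ℝ => powerSum (coeffPlus N g Δ) (1 - x)) 1 :=
      ContDiffAt.comp (1 : ℝ) h2 (contDiffAt_const.sub contDiffAt_id)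
    refine contDiffAt_const.mul (ContDiffAt.mul ?_ h3)
    fun_prop

end Coefficients

/-! ### Reversal of tridiagonal determinants. -/

section Continuant

variable {𝕜 : Type*} [RCLike 𝕜] {N : ℕ} {x y : 𝕜}

/-- A tridiagonal determinant can be expanded from either end: the constraint polynomial describes
the `N`-th term of the reversed recursion. -/
theorem constraint_mul_eq (hN : 0 < N) {P a : ℕ → 𝕜} (hP0 : P 0 = 1) (hP1 : P 1 = x + y - 1)
    (hP : ∀ k : ℕ, P (k + 2) = (((k : 𝕜) + 2) * x + y - ((k : 𝕜) + 2) ^ 2) * P (k + 1)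
      - ((k : 𝕜) + 2) * (k + 1) * ((N : 𝕜) - (k + 2) + 1) * x * P k)
    (ha : ∀ n < N, ((N : 𝕜) - n) * (((n : 𝕜) + 1) * a (n + 1))
      = (((N : 𝕜) - n) * x + y - ((N : 𝕜) - n) ^ 2) * a n
        - ((N : 𝕜) - n) * x * shiftCoeff a n) :
    (N.factorial : 𝕜) * N.factorial * a N = P N * a 0 := by
  -- This normalisation clears the leading factors (N-n)(n+1); with k + 1 = N - j the recursion then
  -- has the coefficients of the one for P, run backwards.
  set A : ℕ → 𝕜 := fun n => (n.factorial : 𝕜) * N.descFactorial n * a n with hA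
  have hrec : ∀ k j : ℕ, N = k + 1 + j → A (j + 1) = (((k : 𝕜) + 1) * x + y - ((k : 𝕜) + 1) ^ 2) * A j
      - ((k : 𝕜) + 2) * (k + 1) * ((N : 𝕜) - (k + 1)) * x * shiftCoeff A j := by
    intro k j hkj
    have h1 := ha j (by omega)
    have h2 : (N : 𝕜) = k + 1 + j := by exact_mod_cast congrArg (Nat.cast : ℕ → 𝕜) hkj
    have h3 : ((N.descFactorial (j + 1) : ℕ) : 𝕜) = (k + 1) * N.descFactorial j := by
      rw [Nat.descFactorial_succ, show N - j = k + 1 by omega]; push_cast; ring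
    rcases j with _ | j
    · simp only [hA, shiftCoeff] at h1 ⊢
      rw [h3, Nat.factorial_succ]
      push_cast at h1 ⊢
      rw [h2] at h1
      push_cast at h1
      linear_combination ((Nat.factorial 0 : 𝕜) * N.descFactorial 0) * h1
    · have h4 : ((N.descFactorial (j + 1) : ℕ) : 𝕜) = (k + 2) * N.descFactorial j := by
        rw [Nat.descFactorial_succ, show N - j = k + 2 by omega]; push_cast; ring
      simp only [hA, shiftCoeff] at h1 ⊢
      rw [h3, h4, Nat.factorial_succ (j + 1), Nat.factorial_succ j]
      push_cast at h1 ⊢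
      rw [h2] at h1 ⊢
      push_cast at h1 ⊢
      linear_combination (((j : 𝕜) + 1) * j.factorial * ((k + 2) * N.descFactorial j)) * h1
  -- Expansion of the determinant at an intermediate place: the expression does not depend on the
  -- cut k + 1 + j = N. The cut k = 0 gives A N, the cut j = 0 gives P N * A 0.
  have hinv : ∀ k j : ℕ, N = k + 1 + j → P (k + 1) * A j
      - ((k : 𝕜) + 2) * (k + 1) * ((N : 𝕜) - (k + 1)) * x * P k * shiftCoeff A j = A N := by
    intro k
    induction k with
    | zero =>
      intro j hj
      have h1 := hrec 0 j hj
      rw [show N = j + 1 by omega] at h1 ⊢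
      rw [h1, zero_add, hP1, hP0]
      push_cast
      ring
    | succ k ih =>
      intro j hj
      rw [← ih (j + 1) (by omega), hrec (k + 1) j hj, hP k]
      simp only [shiftCoeff]
      push_cast
      ring
  have h1 := hinv (N - 1) 0 (by omega)
  rw [show N - 1 + 1 = N by omega] at h1
  simp only [hA, shiftCoeff, Nat.descFactorial_self] at h1
  rw [← h1]
  simp

/-- Elimination of b, after multiplying the second equation by N - n so that no division is needed.
-/
theorem CoeffSystem.lower_recursion {c Δ : 𝕜} {b a : ℕ → 𝕜} (h : CoeffSystem N c Δ b a) (n : ℕ) :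
    ((N : 𝕜) - n) * (((n : 𝕜) + 1) * a (n + 1))
      = (((N : 𝕜) - n) * c + Δ ^ 2 - ((N : 𝕜) - n) ^ 2) * a n
        - ((N : 𝕜) - n) * c * shiftCoeff a n := by
  obtain ⟨h1, h2⟩ := h n
  rw [derivCoeff] at h2
  linear_combination -((N : 𝕜) - n) * h2 - Δ * h1

end Continuant

/-! ### Zeros of p(x) + exp(cx) r(x). -/

section ExponentialPolynomial

open Polynomial

/-- The function `p(x) + exp (c x) r(x)`. -/
def expPoly (c : ℝ) (p r : ℝ[X]) (x : ℝ) : ℝ := p.eval x + Real.exp (c * x) * r.eval x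

/-- The operation `r ↦ c r + r'`. -/
def twistedDeriv (c : ℝ) (r : ℝ[X]) : ℝ[X] := C c * r + derivative r

theorem hasDerivAt_expPoly (c : ℝ) (p r : ℝ[X]) (x : ℝ) :
    HasDerivAt (expPoly c p r) (expPoly c (derivative p) (twistedDeriv c r) x) x := by
  have h1 : HasDerivAt (fun y => c * y) c x := by simpa using (hasDerivAt_id x).const_mul c
  have h2 := (p.hasDerivAt x).add (h1.exp.mul (r.hasDerivAt x))
  refine h2.congr_deriv ?_
  simp only [expPoly, twistedDeriv, eval_add, eval_mul, eval_C]
  ring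

theorem iteratedDeriv_expPoly (c : ℝ) (p r : ℝ[X]) (n : ℕ) : iteratedDeriv n (expPoly c p r)
    = expPoly c (derivative^[n] p) ((twistedDeriv c)^[n] r) := by
  induction n with
  | zero => simp
  | succ n ih =>
    rw [iteratedDeriv_succ, ih, Function.iterate_succ_apply', Function.iterate_succ_apply']
    funext x
    exact (hasDerivAt_expPoly c _ _ x).deriv

theorem continuous_expPoly (c : ℝ) (p r : ℝ[X]) : Continuous (expPoly c p r) :=
  continuous_iff_continuousAt.mpr fun x => (hasDerivAt_expPoly c p r x).continuousAt

theorem natDegree_twistedDeriv_le (c : ℝ) (r : ℝ[X]) :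
    (twistedDeriv c r).natDegree ≤ r.natDegree := by
  refine (natDegree_add_le _ _).trans (max_le (natDegree_C_mul_le _ _) ?_)
  exact (natDegree_derivative_le r).trans (Nat.sub_le _ _)

theorem twistedDeriv_ne_zero {c : ℝ} (hc : c ≠ 0) {r : ℝ[X]} (hr : r ≠ 0) :
    twistedDeriv c r ≠ 0 := by
  intro h
  have h1 := congrArg (fun p => p.coeff r.natDegree) h
  simp only [twistedDeriv, coeff_add, coeff_C_mul, coeff_derivative, coeff_zero,
    coeff_natDegree, coeff_eq_zero_of_natDegree_lt (Nat.lt_succ_self r.natDegree), zero_mul,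
    add_zero, mul_eq_zero, leadingCoeff_eq_zero] at h1
  exact h1.elim hc hr

theorem integral_mul_derivative {F F' : ℝ → ℝ} (hF : ∀ x, HasDerivAt F (F' x) x)
    (hF' : Continuous F') (w : ℝ[X]) :
    ∫ x in (0 : ℝ)..1, F' x * w.eval x
      = F 1 * w.eval 1 - F 0 * w.eval 0 - ∫ x in (0 : ℝ)..1, F x * (derivative w).eval x := by
  have h := intervalIntegral.integral_mul_deriv_eq_deriv_mul (a := 0) (b := 1)
    (u := fun x => w.eval x) (v := F) (u' := fun x => (derivative w).eval x) (v' := F')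
    (fun x _ => w.hasDerivAt x) (fun x _ => hF x)
    ((Polynomial.continuous _).intervalIntegrable _ _) (hF'.intervalIntegrable _ _)
  simp only [mul_comm (F' _), mul_comm (F _)]
  exact h

/-- The `n`-th derivative of a function that vanishes to order `n` at `0` and `1` is orthogonal to
the polynomials of degree less than `n`. -/
theorem integral_expPoly_mul_eq_zero (c : ℝ) (n : ℕ) : ∀ (p r w : ℝ[X]), derivative^[n] w = 0 →
    (∀ j < n, iteratedDeriv j (expPoly c p r) 0 = 0) →
    (∀ j < n, iteratedDeriv j (expPoly c p r) 1 = 0) →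
    ∫ x in (0 : ℝ)..1, iteratedDeriv n (expPoly c p r) x * w.eval x = 0 := by
  intro p r
  induction n with
  | zero =>
    intro w hw _ _
    rw [Function.iterate_zero, id] at hw
    simp [hw]
  | succ n ih =>
    intro w hw h0 h1
    rw [integral_mul_derivative (F := iteratedDeriv n (expPoly c p r)), h0 n (by omega),
      h1 n (by omega), ih (derivative w) hw (fun j hj => h0 j (by omega))
        (fun j hj => h1 j (by omega))]
    · simp
    · intro x
      simp only [iteratedDeriv_expPoly, Function.iterate_succ_apply']
      exact hasDerivAt_expPoly _ _ _ x
    · rw [iteratedDeriv_expPoly]; exact continuous_expPoly _ _ _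

/-- The (N+1)-st derivative kills p and leaves exp(cx) s(x) with deg s < N. The 2N+1 vanishing
conditions make it orthogonal on [0,1] to x s(x), but exp(cx) x s(x)² has positive integral unless s
= 0, and s = 0 only if r = 0. -/
theorem eq_zero_of_expPoly_vanishing {c : ℝ} (hc : c ≠ 0) {N : ℕ} {p r : ℝ[X]}
    (hp : p.natDegree ≤ N) (hr : r.natDegree < N)
    (h0 : ∀ j < N, iteratedDeriv j (expPoly c p r) 0 = 0)
    (h1 : ∀ j ≤ N, iteratedDeriv j (expPoly c p r) 1 = 0) : r = 0 := by
  by_contra hne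
  set s : ℝ[X] := (twistedDeriv c)^[N + 1] r with hs
  have hs_ne : s ≠ 0 := by
    have : ∀ n : ℕ, (twistedDeriv c)^[n] r ≠ 0 := fun n => by
      induction n with
      | zero => exact hne
      | succ n ih => rw [Function.iterate_succ_apply']; exact twistedDeriv_ne_zero hc ih
    exact this _
  have hs_deg : s.natDegree < N := by
    have : ∀ n : ℕ, ((twistedDeriv c)^[n] r).natDegree ≤ r.natDegree := fun n => by
      induction n with
      | zero => exact le_refl _
      | succ n ih =>
        rw [Function.iterate_succ_apply']; exact (natDegree_twistedDeriv_le c _).trans ih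
    exact (this _).trans_lt hr
  -- The factor X compensates for the missing condition at 0: the N-th derivative need not vanish
  -- there, but w does.
  set w : ℝ[X] := X * s with hw
  have hw_deg : w.natDegree < N + 1 := by
    have : w.natDegree ≤ (X : ℝ[X]).natDegree + s.natDegree := natDegree_mul_le
    have := natDegree_X_le (R := ℝ)
    omega
  have hder : ∀ x, iteratedDeriv (N + 1) (expPoly c p r) x = Real.exp (c * x) * s.eval x := by
    intro x
    rw [iteratedDeriv_expPoly, iterate_derivative_eq_zero (by omega), expPoly, eval_zero, zero_add]
  have hint : ∫ x in (0 : ℝ)..1, iteratedDeriv (N + 1) (expPoly c p r) x * w.eval x = 0 := by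
    rw [integral_mul_derivative (F := iteratedDeriv N (expPoly c p r)), h1 N le_rfl,
      integral_expPoly_mul_eq_zero c N p r (derivative w)
        (show derivative^[N + 1] w = 0 from iterate_derivative_eq_zero hw_deg) h0
        (fun j hj => h1 j hj.le)]
    · simp [hw]
    · intro x
      simp only [iteratedDeriv_expPoly, Function.iterate_succ_apply']
      exact hasDerivAt_expPoly _ _ _ x
    · rw [iteratedDeriv_expPoly]; exact continuous_expPoly _ _ _
  have hpos : 0 < ∫ x in (0 : ℝ)..1, iteratedDeriv (N + 1) (expPoly c p r) x * w.eval x := by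
    have e : ∀ x, iteratedDeriv (N + 1) (expPoly c p r) x * w.eval x
        = Real.exp (c * x) * (x * s.eval x ^ 2) := by
      intro x
      rw [hder, hw, eval_mul, eval_X]; ring
    simp only [e]
    refine intervalIntegral.integral_pos zero_lt_one ?_ (fun x hx => ?_) ?_
    · exact Continuous.continuousOn (by fun_prop)
    · have := hx.1.le
      positivity
    · by_contra hno
      push Not at hno
      refine hs_ne (eq_zero_of_infinite_isRoot s ((Set.Ioo_infinite (zero_lt_one (α := ℝ))).mono
        fun x hx => ?_))
      by_contra hroot
      have h2 := hno x ⟨hx.1.le, hx.2.le⟩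
      have h3 : 0 < s.eval x ^ 2 := by
        have : s.eval x ≠ 0 := hroot
        positivity
      have h4 : 0 < Real.exp (c * x) * (x * s.eval x ^ 2) :=
        mul_pos (Real.exp_pos _) (mul_pos hx.1 h3)
      linarith
  exact hpos.ne' hint

end ExponentialPolynomial

/-! ### Non-vanishing of the constraint polynomial. -/

section Juddian

open Polynomial

variable {N : ℕ} {g Δ : ℝ}

/-- The coefficients of `φ_-` for the solution that starts with `1` at `x = 0`. -/
def lowerCoeff (N : ℕ) (x y : ℝ) : ℕ → ℝ
  | 0 => 1
  | 1 => (N * x + y - (N : ℝ) ^ 2) / N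
  | n + 2 => ((((N : ℝ) - (n + 1)) * x + y - ((N : ℝ) - (n + 1)) ^ 2) * lowerCoeff N x y (n + 1)
      - ((N : ℝ) - (n + 1)) * x * lowerCoeff N x y n) / (((N : ℝ) - (n + 1)) * (n + 2))

/-- The coefficients of `φ_+` for the solution that starts with `φ_-(0) = 1`. -/
def lowerCoeffPlus (N : ℕ) (g Δ : ℝ) (n : ℕ) : ℝ :=
  if n = N then 4 * g ^ 2 * shiftCoeff (lowerCoeff N (4 * g ^ 2) (Δ ^ 2)) N / Δ
  else Δ * lowerCoeff N (4 * g ^ 2) (Δ ^ 2) n / ((N : ℝ) - n)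

theorem lowerCoeff_rec {x y : ℝ} {n : ℕ} (hn : n < N) :
    ((N : ℝ) - n) * (((n : ℝ) + 1) * lowerCoeff N x y (n + 1))
      = (((N : ℝ) - n) * x + y - ((N : ℝ) - n) ^ 2) * lowerCoeff N x y n
        - ((N : ℝ) - n) * x * shiftCoeff (lowerCoeff N x y) n := by
  rcases n with _ | n
  · have h1 : (N : ℝ) ≠ 0 := Nat.cast_ne_zero.mpr hn.ne'
    simp only [lowerCoeff, shiftCoeff, Nat.cast_zero, sub_zero]
    field_simp
    ring
  · have h1 : (N : ℝ) - (n + 1) ≠ 0 := by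
      have : ((n + 1 : ℕ) : ℝ) < N := by exact_mod_cast hn
      push_cast at this
      linarith
    have h2 : (n : ℝ) + 2 ≠ 0 := by positivity
    rw [lowerCoeff, shiftCoeff]
    push_cast
    field_simp
    ring

/-- The continuant identity turns P_N = 0 into a_N = 0; two consecutive zeros then terminate the
sequence. -/
theorem lowerCoeff_eq_zero (hN : 0 < N) {x y : ℝ} (hP : constraintP N x y N = 0) :
    ∀ n ≥ N, lowerCoeff N x y n = 0 := by
  have h1 := constraint_mul_eq (x := x) (y := y) hN (P := constraintP N x y) rfl rfl
    (fun k => rfl) (a := lowerCoeff N x y) fun n hn => lowerCoeff_rec hn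
  rw [hP, zero_mul, mul_eq_zero] at h1
  have h2 : lowerCoeff N x y N = 0 := h1.resolve_left (by positivity)
  -- The denominator N - N vanishes at this index, so the value is 0 by the convention for division
  -- by zero. This is the choice that keeps the solution polynomial.
  have h3 : lowerCoeff N x y (N + 1) = 0 := by
    obtain ⟨m, rfl⟩ : ∃ m, N = m + 1 := ⟨N - 1, by omega⟩
    rw [lowerCoeff]
    push_cast
    simp
  have h4 : ∀ j : ℕ, lowerCoeff N x y (N + j) = 0 ∧ lowerCoeff N x y (N + j + 1) = 0 := by
    intro j
    induction j with
    | zero => exact ⟨h2, h3⟩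
    | succ j ih =>
      refine ⟨ih.2, ?_⟩
      rw [← add_assoc, lowerCoeff, ih.1, ih.2]
      simp
  intro n hn
  obtain ⟨j, rfl⟩ := Nat.exists_eq_add_of_le hn
  exact (h4 j).1

/-- At n = N the a-coefficients of index N and N+1 vanish, and the second equation fixes b_N = c
a_{N-1}/Δ. -/
theorem coeffSystem_lowerCoeff (hN : 0 < N) (hΔ : Δ ≠ 0)
    (hP : constraintP N (4 * g ^ 2) (Δ ^ 2) N = 0) :
    CoeffSystem N (4 * g ^ 2) Δ (lowerCoeffPlus N g Δ) (lowerCoeff N (4 * g ^ 2) (Δ ^ 2)) := by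
  have hz := lowerCoeff_eq_zero hN hP
  intro n
  rcases lt_trichotomy n N with h | h | h
  · have h1 := lowerCoeff_rec (x := 4 * g ^ 2) (y := Δ ^ 2) h
    have h2 : (N : ℝ) - n ≠ 0 := by
      have : (n : ℝ) < N := by exact_mod_cast h
      linarith
    rw [lowerCoeffPlus, if_neg h.ne]
    refine ⟨by field_simp; ring, mul_left_cancel₀ h2 ?_⟩
    rw [derivCoeff]
    have h3 : ((N : ℝ) - n) * (Δ * lowerCoeff N (4 * g ^ 2) (Δ ^ 2) n / ((N : ℝ) - n))
        = Δ * lowerCoeff N (4 * g ^ 2) (Δ ^ 2) n := by field_simp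
    linear_combination -h1 + Δ * h3
  · subst h
    rw [lowerCoeffPlus, if_pos rfl, derivCoeff, hz n le_rfl, hz (n + 1) (by omega)]
    refine ⟨by simp, ?_⟩
    field_simp
    ring
  · rw [lowerCoeffPlus, if_neg h.ne', derivCoeff, hz n h.le, hz (n + 1) (by omega)]
    obtain ⟨m, rfl⟩ : ∃ m, n = m + 1 := ⟨n - 1, by omega⟩
    rw [shiftCoeff, hz m (by omega)]
    simp

theorem convergesOn_of_support {a : ℕ → ℝ} {n : ℕ} (h : ∀ i > n, a i = 0) (R : ℝ) :
    ConvergesOn a R := by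
  intro r _ _
  refine summable_of_ne_finset_zero (s := Finset.range (n + 1)) fun i hi => ?_
  rw [Finset.mem_range, not_lt] at hi
  simp [h i (by omega)]

theorem exists_polynomial_of_support {a : ℕ → ℝ} {n : ℕ} (h : ∀ i > n, a i = 0) :
    ∃ p : ℝ[X], p.natDegree ≤ n ∧ ∀ x, powerSum a x = p.eval x := by
  refine ⟨∑ i ∈ Finset.range (n + 1), monomial i (a i), ?_, fun x => ?_⟩
  · refine natDegree_sum_le_of_forall_le _ _ fun i hi => ?_
    exact (natDegree_monomial_le _).trans (by rw [Finset.mem_range] at hi; omega)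
  · rw [powerSum, tsum_eq_sum (s := Finset.range (n + 1)), eval_finsetSum]
    · simp
    · intro i hi
      rw [Finset.mem_range, not_lt] at hi
      simp [h i (by omega)]

/-- A smooth function that is a power series on `(0, 1)` has the expected derivatives at `0`. -/
theorem iteratedDeriv_zero_of_eq_powerSum {f : ℝ → ℝ} {u : ℕ → ℝ} {n : ℕ} (k : ℝ)
    (hf : ContDiffAt ℝ n f 0) (hu : ConvergesOn u 1)
    (h : ∀ x ∈ Set.Ioo (0 : ℝ) 1, f x = k * powerSum u x) :
    iteratedDeriv n f 0 = k * (n.factorial * u n) := by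
  have h1 : (0 : ℝ) < 1 := zero_lt_one
  have hn : ‖(0 : ℝ)‖ < 1 := by simp
  have hlim := (continuousAt_iteratedDeriv hf).tendsto.mono_left
    (nhdsWithin_le_nhds (s := Set.Ioi 0))
  have hlim' := ((hu.derivCoeff_iterate n).hasDerivAt hn).continuousAt.tendsto.mono_left
    (nhdsWithin_le_nhds (s := Set.Ioi 0))
  have hlim'' := hlim'.const_mul k
  rw [powerSum_zero, derivCoeff_iterate_zero] at hlim''
  refine tendsto_nhds_unique_of_eventuallyEq hlim hlim'' ?_
  filter_upwards [Ioo_mem_nhdsGT h1] with x hx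
  have hx1 : ‖x‖ < 1 := by rw [Real.norm_of_nonneg hx.1.le]; exact hx.2
  rw [← hu.iteratedDeriv_eq n hx1, ← iteratedDeriv_const_mul k (hu.contDiffAt n hx1)]
  refine Filter.EventuallyEq.iteratedDeriv_eq n ?_
  filter_upwards [isOpen_Ioo.mem_nhds hx] with y hy using h y hy

/-- The constraint polynomial does not vanish where one of the `G`-functions does. -/
theorem constraintP_ne_zero (hN : 0 < N) (hg : g ≠ 0) (hΔ : Δ ≠ 0)
    (hG : GPlus N g Δ = 0 ∨ GMinus N g Δ = 0) :
    constraintP N (4 * g ^ 2) (Δ ^ 2) N ≠ 0 := by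
  intro hP
  obtain ⟨ε, hε, hφ⟩ := exists_sign_of_G_eq_zero hG
  set c : ℝ := 4 * g ^ 2 with hc
  have hc0 : c ≠ 0 := by positivity
  have hK := convergesOn_coeffK N g Δ
  have hB := hK.coeffPlus
  have hz := lowerCoeff_eq_zero hN hP
  have hsa : ∀ i > N - 1, lowerCoeff N c (Δ ^ 2) i = 0 := fun i hi => hz i (by omega)
  have hsb : ∀ i > N, lowerCoeffPlus N g Δ i = 0 := fun i hi => by
    rw [lowerCoeffPlus, if_neg (by omega), hz i (by omega)]; simp
  obtain ⟨pa, hpa_deg, hpa⟩ := exists_polynomial_of_support hsa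
  obtain ⟨pb, hpb_deg, hpb⟩ := exists_polynomial_of_support hsb
  set E : ℝ → ℝ := fun x => Real.exp (c * x - c / 2) with hE
  -- Projection of the Juddian solution to the parity sector of φ_1.
  set Fp : ℝ → ℝ := fun x => pb.eval x + ε * (E x * pa.eval (1 - x)) with hFp
  set Fm : ℝ → ℝ := fun x => pa.eval x + ε * (E x * pb.eval (1 - x)) with hFm
  have hq : ∀ x ∈ Set.Ioo (0 : ℝ) 1, SolvesAt N c Δ (fun x => pb.eval x) (fun x => pa.eval x) x := by
    intro x hx
    have h1 := (coeffSystem_lowerCoeff hN hΔ hP).solvesAt (convergesOn_of_support hsb 1)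
      (convergesOn_of_support hsa 1) (x := x) (by rw [Real.norm_of_nonneg hx.1.le]; exact hx.2)
    rwa [funext hpb, funext hpa] at h1
  have hF : ∀ x ∈ Set.Ioo (0 : ℝ) 1, SolvesAt N c Δ Fp Fm x := fun x hx =>
    (hq x hx).add ((hq (1 - x) (reflect_mem hx)).reflect.const_mul ε)
  have e1 : ((1 : ℝ) - 1 / 2) = 1 / 2 := by norm_num
  have e2 : E (1 / 2) = 1 := by
    simp only [hE]; rw [show c * (1 / 2) - c / 2 = 0 by ring, Real.exp_zero]
  set s : ℝ := Fp (1 / 2) with hs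
  set β : ℝ := powerSum (coeffPlus N g Δ) (1 / 2) with hβ
  have hFm_half : Fm (1 / 2) = ε * s := by
    simp only [hs, hFp, hFm, e1, e2]
    linear_combination (-pa.eval (1 / 2)) * hε
  -- the solution `φ_1` does not vanish at the fixed point of the parity
  have hβ0 : β ≠ 0 := by
    intro h0
    rw [h0, mul_zero] at hφ
    have h1 : ∀ x ∈ Set.Ioo (0 : ℝ) 1, (0 : ℝ) = 1 * powerSum (coeffPlus N g Δ) x := fun x hx => by
      rw [(eq_zero_of_solvesAt (solvesAt_coeff hΔ) h0 hφ hx).1, mul_zero]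
    have h2 := iteratedDeriv_zero_of_eq_powerSum (n := N) (f := fun _ => (0 : ℝ)) 1
      contDiffAt_const hB h1
    rw [coeffPlus_self, one_mul] at h2
    have h3 : iteratedDeriv N (fun _ : ℝ => (0 : ℝ)) 0 = 0 := by simp
    rw [h3] at h2
    have h4 : (N.factorial : ℝ) * (((N : ℝ) + 1) / Δ) ≠ 0 := by positivity
    exact h4 h2.symm
  -- Both solutions satisfy v(1/2) = ε u(1/2), so they are proportional. The factor s may be 0; the
  -- argument below does not need it to be nonzero.
  have hprop : ∀ x ∈ Set.Ioo (0 : ℝ) 1, Fp x = s / β * powerSum (coeffPlus N g Δ) x ∧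
      Fm x = s / β * powerSum (coeffK N g Δ) x := fun x hx =>
    eq_of_solvesAt hF (fun y hy => (solvesAt_coeff hΔ y hy).const_mul (s / β))
      (by change s = s / β * β; field_simp)
      (by rw [hFm_half, hφ]; field_simp) hx
  have hpoly : ∀ (p : ℝ[X]) (n : ℕ), ContDiff ℝ n fun x : ℝ => p.eval x := fun p n => by
    simpa using p.contDiff_aeval (𝕜 := ℝ) n
  have hFp_smooth : ∀ n : ℕ, ContDiff ℝ n Fp := fun n => by
    have h1 : ContDiff ℝ n fun x : ℝ => pb.eval x := hpoly pb n
    have h2 : ContDiff ℝ n fun x : ℝ => pa.eval (1 - x) :=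
      (hpoly pa n).comp (contDiff_const.sub contDiff_id)
    have h3 : ContDiff ℝ n E := by fun_prop
    exact h1.add (contDiff_const.mul (h3.mul h2))
  have hFm_smooth : ∀ n : ℕ, ContDiff ℝ n Fm := fun n => by
    have h1 : ContDiff ℝ n fun x : ℝ => pa.eval x := hpoly pa n
    have h2 : ContDiff ℝ n fun x : ℝ => pb.eval (1 - x) :=
      (hpoly pb n).comp (contDiff_const.sub contDiff_id)
    have h3 : ContDiff ℝ n E := by fun_prop
    exact h1.add (contDiff_const.mul (h3.mul h2))
  have hFp0 : ∀ j < N, iteratedDeriv j Fp 0 = 0 := fun j hj => by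
    rw [iteratedDeriv_zero_of_eq_powerSum (s / β) (hFp_smooth j).contDiffAt hB
      fun x hx => (hprop x hx).1, coeffPlus_of_lt hj]
    ring
  have hFm0 : ∀ j ≤ N, iteratedDeriv j Fm 0 = 0 := fun j hj => by
    rw [iteratedDeriv_zero_of_eq_powerSum (s / β) (hFm_smooth j).contDiffAt hK
      fun x hx => (hprop x hx).2, coeffK_of_le g Δ hj]
    ring
  have hrefl : Fp = (fun x => ε * E x) * fun x => Fm (1 - x) := by
    funext x
    have h1 : E x * E (1 - x) = 1 := by
      simp only [hE]
      rw [← Real.exp_add, show c * x - c / 2 + (c * (1 - x) - c / 2) = 0 by ring, Real.exp_zero]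
    simp only [hFp, hFm, Pi.mul_apply, sub_sub_cancel]
    linear_combination (-(ε * ε * pb.eval x)) * h1 - pb.eval x * hε
  -- Parity carries the zero of order N+1 of Fm at 0 to a zero of Fp at 1, by the Leibniz rule.
  have hFp1 : ∀ j ≤ N, iteratedDeriv j Fp 1 = 0 := fun j hj => by
    have h1 : ContDiffAt ℝ j (fun x => ε * E x) 1 := by fun_prop
    have h2 : ContDiffAt ℝ j (fun x => Fm (1 - x)) 1 :=
      ((hFm_smooth j).comp (contDiff_const.sub contDiff_id)).contDiffAt
    rw [hrefl, iteratedDeriv_mul h1 h2]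
    refine Finset.sum_eq_zero fun i _ => ?_
    rw [iteratedDeriv_comp_const_sub]
    simp [hFm0 (j - i) (by omega)]
  set pr : ℝ[X] := C (ε * Real.exp (-(c / 2))) * pa.comp (1 - X) with hpr
  have hFp_exp : Fp = expPoly c pb pr := by
    funext x
    simp only [hFp, hE, expPoly, hpr, eval_mul, eval_C, eval_comp, eval_sub, eval_one, eval_X]
    rw [sub_eq_add_neg (c * x), Real.exp_add]
    ring
  rw [hFp_exp] at hFp0 hFp1
  have hlin : (1 - X : ℝ[X]).natDegree ≤ 1 := by
    refine (natDegree_sub_le _ _).trans ?_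
    simp
  have hpr_deg : pr.natDegree < N := by
    have h1 : pr.natDegree ≤ pa.natDegree * (1 - X : ℝ[X]).natDegree :=
      (natDegree_C_mul_le _ _).trans natDegree_comp_le
    have h2 : pa.natDegree * (1 - X : ℝ[X]).natDegree ≤ pa.natDegree * 1 :=
      Nat.mul_le_mul_left _ hlin
    omega
  have hpr0 := eq_zero_of_expPoly_vanishing hc0 hpb_deg hpr_deg hFp0 hFp1
  -- The normalisation pa(0) = 1 keeps the exponential part from being zero.
  have h1 : pr.eval 1 = ε * Real.exp (-(c / 2)) := by
    have h2 : pa.eval 0 = 1 := by rw [← hpa, powerSum_zero, lowerCoeff]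
    simp [hpr, eval_comp, h2]
  rw [hpr0, eval_zero] at h1
  have hε0 : ε ≠ 0 := by rintro rfl; simp at hε
  exact mul_ne_zero hε0 (Real.exp_pos _).ne' h1.symm

end Juddian

/-! ### Exponential type and the Bargmann space. -/

section Growth

variable {a : ℕ → ℂ} {A B : ℝ}

theorem hasSum_exp_bound (A B r : ℝ) :
    HasSum (fun n : ℕ => A * (B ^ n / n.factorial) * r ^ n) (A * Real.exp (B * r)) := by
  have h := (NormedSpace.expSeries_div_hasSum_exp (𝔸 := ℝ) (B * r)).mul_left A
  rw [← Real.exp_eq_exp_ℝ] at h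
  refine h.congr_fun fun n => ?_
  rw [mul_pow]
  ring

theorem convergesOn_of_norm_le (h : ∀ n, ‖a n‖ ≤ A * (B ^ n / n.factorial)) (R : ℝ) :
    ConvergesOn a R := fun r h0 _ =>
  Summable.of_nonneg_of_le (fun n => by positivity)
    (fun n => mul_le_mul_of_nonneg_right (h n) (by positivity)) (hasSum_exp_bound A B r).summable

theorem norm_powerSum_le (h : ∀ n, ‖a n‖ ≤ A * (B ^ n / n.factorial)) (x : ℂ) :
    ‖powerSum a x‖ ≤ A * Real.exp (B * ‖x‖) := by
  refine tsum_of_norm_bounded (hasSum_exp_bound A B ‖x‖) fun n => ?_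
  rw [norm_mul, norm_pow]
  exact mul_le_mul_of_nonneg_right (h n) (by positivity)

theorem integrable_exp_neg_half_norm_sq :
    Integrable (fun z : ℂ => Real.exp (-(‖z‖ ^ 2 / 2))) volume := by
  have h := (GaussianFourier.integrable_cexp_neg_mul_sq_norm_add (V := ℂ) (b := 1 / 2)
    (by norm_num) 0 0).norm
  refine h.congr (Filter.Eventually.of_forall fun z => ?_)
  simp only [Complex.norm_exp]
  congr 1
  have e : (-(1 / 2 : ℂ) * (‖z‖ : ℂ) ^ 2 + 0 * ((inner ℝ (0 : ℂ) z : ℝ) : ℂ))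
      = ((-(‖z‖ ^ 2 / 2) : ℝ) : ℂ) := by
    push_cast; ring
  rw [e, Complex.ofReal_re]

/-- Entire functions of exponential type lie in the Bargmann space. -/
theorem mem_bargmannSpace_of_norm_le {f : ℂ → ℂ} (hf : Differentiable ℂ f) {D : ℝ}
    (h : ∀ z, ‖f z‖ ≤ A * Real.exp (D * ‖z‖)) : f ∈ bargmannSpace := by
  refine ⟨hf, (integrable_exp_neg_half_norm_sq.const_mul (A ^ 2 * Real.exp (2 * D ^ 2))).mono' ?_
    (Filter.Eventually.of_forall fun z => ?_)⟩
  · have := hf.continuous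
    exact Continuous.aestronglyMeasurable (by fun_prop)
  · rw [Real.norm_of_nonneg (by positivity)]
    calc ‖f z‖ ^ 2 * Real.exp (-‖z‖ ^ 2)
        ≤ (A * Real.exp (D * ‖z‖)) ^ 2 * Real.exp (-‖z‖ ^ 2) := by gcongr; exact h z
      _ = A ^ 2 * Real.exp (2 * (D * ‖z‖) + -‖z‖ ^ 2) := by
          rw [mul_pow, ← Real.exp_nat_mul, mul_assoc, ← Real.exp_add]; push_cast; rfl
      _ ≤ A ^ 2 * Real.exp (2 * D ^ 2 + -(‖z‖ ^ 2 / 2)) := by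
          refine mul_le_mul_of_nonneg_left (Real.exp_le_exp.mpr ?_) (sq_nonneg A)
          -- 2D‖z‖ ≤ 2D² + ‖z‖²/2, so half of the Gaussian weight survives.
          nlinarith [sq_nonneg (‖z‖ - 2 * D)]
      _ = _ := by rw [Real.exp_add, mul_assoc]

end Growth

/-! ### Complex power series solutions at 0. -/

section ComplexSystem

variable {N : ℕ} {g Δ : ℝ}

theorem coeffSystem_complex (hΔ : Δ ≠ 0) : CoeffSystem N (4 * (g : ℂ) ^ 2) (Δ : ℂ)
    (fun n => (coeffPlus N g Δ n : ℂ)) (fun n => (coeffK N g Δ n : ℂ)) := by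
  intro n
  obtain ⟨h1, h2⟩ := coeffSystem_coeffK (N := N) (g := g) hΔ n
  have e : shiftCoeff (fun n => (coeffK N g Δ n : ℂ)) n
      = ((shiftCoeff (coeffK N g Δ) n : ℝ) : ℂ) := by
    cases n <;> simp [shiftCoeff]
  rw [e]
  rw [derivCoeff] at h2 ⊢
  have h3 := congrArg (fun t : ℝ => (t : ℂ)) h1
  have h4 := congrArg (fun t : ℝ => (t : ℂ)) h2
  push_cast at h3 h4
  exact ⟨h3, h4⟩

theorem exists_coeffPlus_bound {A B : ℝ} (hB : 0 < B)
    (h : ∀ n, |coeffK N g Δ n| ≤ A * (B ^ n / n.factorial)) :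
    ∃ A' : ℝ, ∀ n, |coeffPlus N g Δ n| ≤ A' * (B ^ n / n.factorial) := by
  have hA : 0 ≤ A := by simpa using (abs_nonneg _).trans (h 0)
  refine ⟨|Δ| * A + |coeffPlus N g Δ N| / (B ^ N / N.factorial), fun n => ?_⟩
  rw [add_mul]
  by_cases hn : n = N
  · subst hn
    rw [div_mul_cancel₀ _ (by positivity)]
    have : 0 ≤ |Δ| * A * (B ^ n / n.factorial) := by positivity
    linarith
  · refine ((abs_coeffPlus_le hn).trans (mul_le_mul_of_nonneg_left (h n) (abs_nonneg _))).trans ?_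
    have : 0 ≤ |coeffPlus N g Δ N| / (B ^ N / N.factorial) * (B ^ n / n.factorial) := by positivity
    rw [← mul_assoc]
    linarith

theorem phiMinus_eq (hK : ∀ R, ConvergesOn (fun n => (coeffK N g Δ n : ℂ)) R) (x : ℂ) :
    phiMinus N g Δ x = powerSum (fun n => (coeffK N g Δ n : ℂ)) x := by
  have h := (hasSum_nat_add_iff' (N + 1)).mpr ((hK (‖x‖ + 1)).hasSum (lt_add_one ‖x‖))
  rw [Finset.sum_eq_zero fun i hi => by
    rw [coeffK_of_le g Δ (by rw [Finset.mem_range] at hi; omega)]; simp, sub_zero] at h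
  rw [phiMinus, ← h.tsum_eq]
  exact tsum_congr fun k => by rw [add_comm k]

theorem phiPlus_eq (hB : ∀ R, ConvergesOn (fun n => (coeffPlus N g Δ n : ℂ)) R) (x : ℂ) :
    phiPlus N g Δ x = powerSum (fun n => (coeffPlus N g Δ n : ℂ)) x := by
  have h := (hasSum_nat_add_iff' (N + 1)).mpr ((hB (‖x‖ + 1)).hasSum (lt_add_one ‖x‖))
  rw [Finset.sum_range_succ, Finset.sum_eq_zero fun i hi => by
    rw [coeffPlus_of_lt (Finset.mem_range.mp hi)]; simp, zero_add, coeffPlus_self] at h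
  have h1 : ∀ k : ℕ, (coeffPlus N g Δ (k + (N + 1)) : ℂ) * x ^ (k + (N + 1))
      = -(Δ : ℂ) * ((coeffK N g Δ (N + 1 + k) : ℂ) / ((k : ℂ) + 1) * x ^ (N + 1 + k)) := by
    intro k
    rw [add_comm k, coeffPlus_add]
    push_cast
    ring
  have h2 := h.tsum_eq
  simp only [h1, tsum_mul_left] at h2
  rw [phiPlus]
  push_cast at h2
  linear_combination h2

theorem CoeffSystem.sub_const_mul {c D k : ℂ} {b a b₁ a₁ : ℕ → ℂ} (h : CoeffSystem N c D b a)
    (h₁ : CoeffSystem N c D b₁ a₁) :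
    CoeffSystem N c D (fun n => b n - k * b₁ n) (fun n => a n - k * a₁ n) := by
  intro n
  obtain ⟨h1, h2⟩ := h n
  obtain ⟨h3, h4⟩ := h₁ n
  have e : shiftCoeff (fun n => a n - k * a₁ n) n = shiftCoeff a n - k * shiftCoeff a₁ n := by
    cases n <;> simp [shiftCoeff]
  rw [e]
  rw [derivCoeff] at h2 h4 ⊢
  exact ⟨by linear_combination h1 - k * h3, by linear_combination h2 - k * h4⟩

/-- The second equation determines a_{n+1} from earlier terms, and the first determines b_n from a_n
except at n = N, so a_0 and b_N are the only free data. -/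
theorem CoeffSystem.eq_zero {c D : ℂ} {b a : ℕ → ℂ} (h : CoeffSystem N c D b a)
    (ha : a 0 = 0) (hb : b N = 0) (n : ℕ) : b n = 0 ∧ a n = 0 := by
  have hb' : ∀ n, a n = 0 → b n = 0 := by
    intro n hn
    by_cases hnN : n = N
    · rw [hnN, hb]
    · have h1 := (h n).1
      rw [hn, mul_zero, neg_zero, mul_eq_zero, sub_eq_zero] at h1
      exact h1.resolve_left (by exact_mod_cast hnN)
  suffices H : ∀ n, a n = 0 from ⟨hb' n (H n), H n⟩
  intro n
  induction n using Nat.strong_induction_on with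
  | _ n ih =>
    rcases n with _ | n
    · exact ha
    · have h0 := ih n (by omega)
      have h1 := (h n).2
      have h2 : shiftCoeff a n = 0 := by
        rcases n with _ | n
        · rfl
        · exact ih n (by omega)
      rw [h2, h0, hb' n h0, derivCoeff] at h1
      have h3 : ((n : ℂ) + 1) * a (n + 1) = 0 := by linear_combination -h1
      exact (mul_eq_zero.mp h3).resolve_left (Nat.cast_add_one_ne_zero n)

/-- If the constraint polynomial does not vanish, the solutions that are analytic at `0` are the
multiples of `φ_1`. -/
theorem CoeffSystem.eq_const_mul (hN : 0 < N) (hΔ : Δ ≠ 0)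
    (hP : constraintP N (4 * g ^ 2) (Δ ^ 2) N ≠ 0) {b a : ℕ → ℂ}
    (h : CoeffSystem N (4 * (g : ℂ) ^ 2) (Δ : ℂ) b a) :
    ∃ k : ℂ, ∀ n, b n = k * (coeffPlus N g Δ n : ℂ) ∧ a n = k * (coeffK N g Δ n : ℂ) := by
  have hΔ' : (Δ : ℂ) ≠ 0 := by exact_mod_cast hΔ
  have h1 := constraint_mul_eq (x := 4 * (g : ℂ) ^ 2) (y := (Δ : ℂ) ^ 2) hN
    (P := fun k => (constraintP N (4 * g ^ 2) (Δ ^ 2) k : ℂ)) (by simp [constraintP])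
    (by simp [constraintP]) (fun k => by rw [constraintP]; push_cast; ring) (a := a)
    fun n _ => h.lower_recursion n
  -- The first equation degenerates at n = N; this is the obstruction that P_N ≠ 0 turns into a_0 =
  -- 0.
  have haN : a N = 0 := by
    have h2 := (h N).1
    rw [sub_self, zero_mul, eq_comm, neg_eq_zero, mul_eq_zero] at h2
    exact h2.resolve_left hΔ'
  rw [haN, mul_zero, eq_comm, mul_eq_zero] at h1
  have ha0 : a 0 = 0 := h1.resolve_left (by exact_mod_cast hP)
  have hBN : (coeffPlus N g Δ N : ℂ) ≠ 0 := by
    rw [coeffPlus_self]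
    have : ((N : ℝ) + 1) / Δ ≠ 0 := by positivity
    exact_mod_cast this
  refine ⟨b N / coeffPlus N g Δ N, fun n => ?_⟩
  have h3 := (h.sub_const_mul (k := b N / coeffPlus N g Δ N)
    (coeffSystem_complex hΔ)).eq_zero (by simp [ha0, coeffK_of_le g Δ hN.le])
    (by rw [div_mul_cancel₀ _ hBN, sub_self]) n
  exact ⟨sub_eq_zero.mp h3.1, sub_eq_zero.mp h3.2⟩

end ComplexSystem

/-! ### Translation between eigenfunctions and the system. -/

section Eigenspace

variable {N : ℕ} {g Δ : ℝ}

/-- The two-component function attached to a pair `(u, v)` in place of `(φ_{1,+}, φ_{1,-})`. -/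
def spinor (g : ℝ) (u v : ℂ → ℂ) : Fin 2 → ℂ → ℂ := fun i z =>
  ![(Complex.exp (-(g * z)) * u ((z + g) / (2 * g))
      + Complex.exp (-(g * z)) * v ((z + g) / (2 * g))) / 2,
    (Complex.exp (-(g * z)) * u ((z + g) / (2 * g))
      - Complex.exp (-(g * z)) * v ((z + g) / (2 * g))) / 2] i

theorem hasDerivAt_exp_mul_comp {u : ℂ → ℂ} {u' z : ℂ}
    (hu : HasDerivAt u u' ((z + g) / (2 * g))) :
    HasDerivAt (fun z : ℂ => Complex.exp (-(g * z)) * u ((z + g) / (2 * g)))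
      (Complex.exp (-(g * z)) * (u' / (2 * g) - g * u ((z + g) / (2 * g)))) z := by
  have h1 : HasDerivAt (fun z : ℂ => (z + g) / (2 * g)) (1 / (2 * g)) z :=
    ((hasDerivAt_id z).add_const (g : ℂ)).div_const _
  have h2 : HasDerivAt (fun z : ℂ => -((g : ℂ) * z)) (-(g * 1)) z :=
    ((hasDerivAt_id z).const_mul (g : ℂ)).neg
  have h3 := h2.cexp.mul (hu.comp z h1)
  refine h3.congr_deriv ?_
  rw [Function.comp_apply]
  ring

/-- The sum and difference of the two rows diagonalise σ_x and have leading coefficients z + g = 2gx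
and z - g = 2g(x-1), the singular factors of the system. -/
theorem hamiltonian_spinor (hg : g ≠ 0) {u v : ℂ → ℂ} {z : ℂ}
    (h : SolvesAt N (4 * (g : ℂ) ^ 2) (Δ : ℂ) u v ((z + g) / (2 * g))) (i : Fin 2) :
    hamiltonian g Δ (spinor g u v) i z = ((N : ℂ) - g ^ 2) * spinor g u v i z := by
  have hg' : (g : ℂ) ≠ 0 := by exact_mod_cast hg
  obtain ⟨u', v', hu, hv, h1, h2⟩ := h
  have hfp := hasDerivAt_exp_mul_comp hu
  have hfm := hasDerivAt_exp_mul_comp hv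
  have d0 : deriv (spinor g u v 0) z = _ := ((hfp.add hfm).div_const 2).deriv
  have d1 : deriv (spinor g u v 1) z = _ := ((hfp.sub hfm).div_const 2).deriv
  set U := u ((z + g) / (2 * g))
  set V := v ((z + g) / (2 * g))
  set E := Complex.exp (-(g * z))
  have s0 : spinor g u v 0 z = (E * U + E * V) / 2 := rfl
  have s1 : spinor g u v 1 z = (E * U - E * V) / 2 := rfl
  have h1' : (z + g) * (u' / (2 * g)) = N * U - Δ * V := by
    rw [← h1]; field_simp
  have h2' : (z - g) * (v' / (2 * g)) = (2 * g * (z - g) + N) * V - Δ * U := by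
    have e : (z - g) * (v' / (2 * g)) = ((z + g) / (2 * g) - 1) * v' := by field_simp; ring
    rw [e, h2]
    field_simp
    ring
  fin_cases i
  · change hamiltonian g Δ (spinor g u v) 0 z = _ * spinor g u v 0 z
    simp only [hamiltonian, pauliX, pauliZ, Fin.sum_univ_two, d0, d1, s0, s1, Matrix.of_apply,
      Matrix.cons_val_zero, Matrix.cons_val_one, Matrix.cons_val']
    linear_combination (E / 2) * h1' + (E / 2) * h2'
  · change hamiltonian g Δ (spinor g u v) 1 z = _ * spinor g u v 1 z
    simp only [hamiltonian, pauliX, pauliZ, Fin.sum_univ_two, d0, d1, s0, s1, Matrix.of_apply,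
      Matrix.cons_val_zero, Matrix.cons_val_one, Matrix.cons_val']
    linear_combination (E / 2) * h1' - (E / 2) * h2'

theorem solvesAt_of_hamiltonian {ψ : Fin 2 → ℂ → ℂ}
    (hd : ∀ i, Differentiable ℂ (ψ i))
    (h : ∀ i z, hamiltonian g Δ ψ i z = ((N : ℂ) - g ^ 2) * ψ i z) (x : ℂ) :
    SolvesAt N (4 * (g : ℂ) ^ 2) (Δ : ℂ)
      (fun x => Complex.exp (g * (2 * g * x - g)) * (ψ 0 (2 * g * x - g) + ψ 1 (2 * g * x - g)))
      (fun x => Complex.exp (g * (2 * g * x - g)) * (ψ 0 (2 * g * x - g) - ψ 1 (2 * g * x - g)))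
      x := by
  set z : ℂ := 2 * g * x - g with hz
  have hzx : HasDerivAt (fun x : ℂ => 2 * g * x - g) (2 * g : ℂ) x := by
    simpa using ((hasDerivAt_id x).const_mul (2 * g : ℂ)).sub_const (g : ℂ)
  have hE : HasDerivAt (fun x : ℂ => Complex.exp (g * (2 * g * x - g)))
      (Complex.exp (g * z) * (g * (2 * g))) x := (hzx.const_mul (g : ℂ)).cexp
  have h0 : HasDerivAt (fun x : ℂ => ψ 0 (2 * g * x - g)) (deriv (ψ 0) z * (2 * g)) x :=
    HasDerivAt.comp x (hd 0 z).hasDerivAt hzx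
  have h1 : HasDerivAt (fun x : ℂ => ψ 1 (2 * g * x - g)) (deriv (ψ 1) z * (2 * g)) x :=
    HasDerivAt.comp x (hd 1 z).hasDerivAt hzx
  refine ⟨_, _, hE.mul (h0.add h1), hE.mul (h0.sub h1), ?_, ?_⟩
  all_goals
    have e0 := h 0 z
    have e1 := h 1 z
    simp only [hamiltonian, pauliX, pauliZ, Fin.sum_univ_two, Matrix.of_apply,
      Matrix.cons_val_zero, Matrix.cons_val_one, Matrix.cons_val'] at e0 e1
    have hx : 2 * g * x = z + g := by rw [hz]; ring
  · simp only [← hz]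
    linear_combination Complex.exp (g * z) * (e0 + e1)
      + Complex.exp (g * z) * (g * (ψ 0 z + ψ 1 z) + deriv (ψ 0) z + deriv (ψ 1) z) * hx
  · simp only [← hz]
    linear_combination Complex.exp (g * z) * (e0 - e1)
      + Complex.exp (g * z) * (-g * (ψ 0 z - ψ 1 z) + deriv (ψ 0) z - deriv (ψ 1) z) * hx

theorem exp_comp_mem_bargmannSpace (hg : g ≠ 0) {a : ℕ → ℂ} {A B : ℝ} (hB : 0 < B)
    (h : ∀ n, ‖a n‖ ≤ A * (B ^ n / n.factorial)) :
    (fun z : ℂ => Complex.exp (-(g * z)) * powerSum a ((z + g) / (2 * g))) ∈ bargmannSpace := by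
  have hA : 0 ≤ A := by simpa using (norm_nonneg _).trans (h 0)
  have hg' : 0 < |g| := abs_pos.mpr hg
  refine mem_bargmannSpace_of_norm_le (A := A * Real.exp (B / 2)) (D := |g| + B / (2 * |g|))
    (fun z => ?_) fun z => ?_
  · exact (hasDerivAt_exp_mul_comp
      ((convergesOn_of_norm_le h _).hasDerivAt (lt_add_one ‖(z + g) / (2 * g)‖))).differentiableAt
  · have h1 : ‖(z + g) / (2 * (g : ℂ))‖ ≤ (‖z‖ + |g|) / (2 * |g|) := by
      rw [norm_div, norm_mul, Complex.norm_real, Real.norm_eq_abs, Complex.norm_ofNat]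
      gcongr
      exact (norm_add_le _ _).trans (by rw [Complex.norm_real, Real.norm_eq_abs])
    have h2 : ‖Complex.exp (-(g * z))‖ ≤ Real.exp (|g| * ‖z‖) := by
      refine (Complex.norm_exp_le_exp_norm _).trans ?_
      rw [norm_neg, norm_mul, Complex.norm_real, Real.norm_eq_abs]
    have h3 : ‖powerSum a ((z + g) / (2 * g))‖
        ≤ A * Real.exp (B * ((‖z‖ + |g|) / (2 * |g|))) :=
      (norm_powerSum_le h _).trans (by gcongr)
    rw [norm_mul]
    refine (mul_le_mul h2 h3 (norm_nonneg _) (Real.exp_pos _).le).trans (le_of_eq ?_)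
    rw [mul_left_comm, mul_assoc, ← Real.exp_add, ← Real.exp_add]
    congr 2
    field_simp
    ring

theorem eigenstate_eq_spinor (N : ℕ) (g Δ : ℝ) :
    eigenstate N g Δ = spinor g (phiPlus N g Δ) (phiMinus N g Δ) := rfl

theorem phiPlus_ne_zero (hΔ : Δ ≠ 0)
    (hB : ∀ R, ConvergesOn (fun n => (coeffPlus N g Δ n : ℂ)) R) : phiPlus N g Δ ≠ 0 := by
  intro h
  have h1 := coeff_eq_zero_of_powerSum_eq_zero (hB 1) zero_lt_one
    (fun x _ => by rw [← phiPlus_eq hB, h]; rfl) N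
  rw [coeffPlus_self] at h1
  have h2 : ((N : ℝ) + 1) / Δ ≠ 0 := by positivity
  exact h2 (by exact_mod_cast h1)

theorem eigenstate_ne_zero (hg : g ≠ 0) (hφ : phiPlus N g Δ ≠ 0) : eigenstate N g Δ ≠ 0 := by
  intro h
  refine hφ (funext fun x => ?_)
  have hg' : (g : ℂ) ≠ 0 := by exact_mod_cast hg
  have h0 : eigenstate N g Δ 0 (2 * g * x - g) = 0 := by rw [h]; rfl
  have h1 : eigenstate N g Δ 1 (2 * g * x - g) = 0 := by rw [h]; rfl
  rw [eigenstate_eq_spinor] at h0 h1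
  simp only [spinor, Matrix.cons_val_zero, Matrix.cons_val_one] at h0 h1
  have e : (2 * g * x - g + g) / (2 * (g : ℂ)) = x := by field_simp; ring
  rw [e] at h0 h1
  have h2 : Complex.exp (-(g * (2 * g * x - g))) * phiPlus N g Δ x = 0 := by
    linear_combination h0 + h1
  exact (mul_eq_zero.mp h2).resolve_left (Complex.exp_ne_zero _)

theorem eigenstate_mem_eigenspace (hg : g ≠ 0) (hΔ : Δ ≠ 0) {A B : ℝ} (hB0 : 0 < B)
    (hK : ∀ n, |coeffK N g Δ n| ≤ A * (B ^ n / n.factorial)) :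
    eigenstate N g Δ ∈ eigenspace g Δ (N - g ^ 2) := by
  obtain ⟨A', hB⟩ := exists_coeffPlus_bound hB0 hK
  have hK' : ∀ n, ‖(coeffK N g Δ n : ℂ)‖ ≤ A * (B ^ n / n.factorial) := fun n => by
    rw [Complex.norm_real]; exact hK n
  have hB' : ∀ n, ‖(coeffPlus N g Δ n : ℂ)‖ ≤ A' * (B ^ n / n.factorial) := fun n => by
    rw [Complex.norm_real]; exact hB n
  have hKc := convergesOn_of_norm_le hK'
  have hBc := convergesOn_of_norm_le hB'
  rw [eigenstate_eq_spinor, funext (phiPlus_eq hBc), funext (phiMinus_eq hKc)]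
  have hp := exp_comp_mem_bargmannSpace hg hB0 hB'
  have hm := exp_comp_mem_bargmannSpace hg hB0 hK'
  refine ⟨fun i => ?_, ?_⟩
  · fin_cases i
    · convert! bargmannSpace.smul_mem (1 / 2 : ℂ) (bargmannSpace.add_mem hp hm) using 1
      funext z
      simp [spinor]
      ring
    · convert! bargmannSpace.smul_mem (1 / 2 : ℂ) (bargmannSpace.sub_mem hp hm) using 1
      funext z
      simp [spinor]
      ring
  · funext i z
    rw [hamiltonian_spinor (N := N) hg ((coeffSystem_complex hΔ).solvesAt (hBc _) (hKc _)
      (lt_add_one ‖(z + g) / (2 * g)‖))]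
    simp

theorem exists_convergesOn_of_differentiable {f : ℂ → ℂ} (hf : Differentiable ℂ f) :
    ∃ a : ℕ → ℂ, (∀ R, ConvergesOn a R) ∧ powerSum a = f := by
  have h : ∀ x, HasSum (fun n : ℕ => ((n.factorial : ℂ)⁻¹ * iteratedDeriv n f 0) * x ^ n) (f x) :=
    fun x => (Complex.hasSum_taylorSeries_of_entire hf 0 x).congr_fun fun n => by
      simp only [sub_zero, smul_eq_mul]; ring
  exact ⟨_, fun R => convergesOn_of_summable fun x _ => (h x).summable,
    funext fun x => (h x).tsum_eq⟩

/-- If the constraint polynomial does not vanish, every eigenfunction is a multiple of `ψ`. -/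
theorem eigenspace_le_span (hN : 0 < N) (hg : g ≠ 0) (hΔ : Δ ≠ 0)
    (hP : constraintP N (4 * g ^ 2) (Δ ^ 2) N ≠ 0)
    (hK : ∀ R, ConvergesOn (fun n => (coeffK N g Δ n : ℂ)) R)
    (hB : ∀ R, ConvergesOn (fun n => (coeffPlus N g Δ n : ℂ)) R) :
    eigenspace g Δ (N - g ^ 2) ≤ Submodule.span ℂ {eigenstate N g Δ} := by
  rintro ψ ⟨h1, h2⟩
  have hg' : (g : ℂ) ≠ 0 := by exact_mod_cast hg
  have hd : ∀ i, Differentiable ℂ (ψ i) := fun i => (h1 i).1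
  have hs := solvesAt_of_hamiltonian (N := N) (g := g) (Δ := Δ) hd fun i z => by rw [h2]; simp
  obtain ⟨b, hb, hbu⟩ := exists_convergesOn_of_differentiable
    (f := fun x : ℂ => Complex.exp (g * (2 * g * x - g))
      * (ψ 0 (2 * g * x - g) + ψ 1 (2 * g * x - g)))
    (by have := hd 0; have := hd 1; fun_prop)
  obtain ⟨a, ha, hav⟩ := exists_convergesOn_of_differentiable
    (f := fun x : ℂ => Complex.exp (g * (2 * g * x - g))
      * (ψ 0 (2 * g * x - g) - ψ 1 (2 * g * x - g)))
    (by have := hd 0; have := hd 1; fun_prop)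
  rw [← hbu, ← hav] at hs
  obtain ⟨k, hk⟩ := (CoeffSystem.of_solvesAt (hb 1) (ha 1) zero_lt_one
    fun x _ => hs x).eq_const_mul hN hΔ hP
  have hbk : ∀ x, powerSum b x = k * phiPlus N g Δ x := fun x => by
    rw [phiPlus_eq hB, powerSum, powerSum, ← tsum_mul_left]
    exact tsum_congr fun n => by rw [(hk n).1]; ring
  have hak : ∀ x, powerSum a x = k * phiMinus N g Δ x := fun x => by
    rw [phiMinus_eq hK, powerSum, powerSum, ← tsum_mul_left]
    exact tsum_congr fun n => by rw [(hk n).2]; ring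
  refine Submodule.mem_span_singleton.mpr ⟨k, ?_⟩
  funext i z
  have e : 2 * (g : ℂ) * ((z + g) / (2 * g)) - g = z := by field_simp; ring
  have h3 := hbk ((z + g) / (2 * g))
  have h4 := hak ((z + g) / (2 * g))
  simp only [hbu, hav, e] at h3 h4
  have h5 : Complex.exp (-(g * z)) * Complex.exp (g * z) = 1 := by
    rw [← Complex.exp_add, neg_add_cancel, Complex.exp_zero]
  rw [eigenstate_eq_spinor]
  fin_cases i
  · change k * spinor g _ _ 0 z = ψ 0 z
    simp only [spinor, Matrix.cons_val_zero]
    linear_combination (-Complex.exp (-(g * z)) / 2) * (h3 + h4) + ψ 0 z * h5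
  · change k * spinor g _ _ 1 z = ψ 1 z
    simp only [spinor, Matrix.cons_val_one, Matrix.cons_val_zero]
    linear_combination (-Complex.exp (-(g * z)) / 2) * (h3 - h4) + ψ 1 z * h5

end Eigenspace

/-! ### Membership in the completed discrete series. -/

section DiscreteSeries

variable {N : ℕ} {g Δ : ℝ}

/-- Finite truncations lie in the span and converge coefficientwise. -/
theorem mem_closure_discreteSeriesPlus {c : FormalSeries}
    (h : ∀ k : ℤ, k < ((N / 2 : ℕ) : ℤ) → c k = 0) :
    c ∈ (discreteSeriesPlus N).topologicalClosure := by
  have h1 : HasSum (fun k : ℤ => c k • basisVec k) c := by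
    rw [Pi.hasSum]
    intro i
    have h2 := hasSum_single (f := fun k : ℤ => (c k • basisVec k) i) i fun k hk => by
      simp [basisVec, hk.symm]
    simpa [basisVec] using h2
  rw [← SetLike.mem_coe, Submodule.topologicalClosure_coe]
  refine mem_closure_of_tendsto h1 (Filter.Eventually.of_forall fun s => ?_)
  refine Submodule.sum_mem _ fun k _ => ?_
  by_cases hk : k < ((N / 2 : ℕ) : ℤ)
  · rw [h k hk, zero_smul]; exact Submodule.zero_mem _
  · exact Submodule.smul_mem _ _ (Submodule.subset_span ⟨k, not_lt.mp hk, rfl⟩)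

theorem familyOf_shift (N : ℕ) :
    -(((N + 1) / 2 : ℕ) : ℂ) + (familyOf N).shift = (-(N : ℂ) - 1 / 2) / 2 := by
  rcases Nat.even_or_odd' N with ⟨m, hm | hm⟩
  · have h2 : (N + 1) / 2 = m := by omega
    have h3 : Even N := ⟨m, by omega⟩
    rw [h2, familyOf, if_pos h3, Family.shift, hm]
    push_cast
    ring
  · have h2 : (N + 1) / 2 = m + 1 := by omega
    have h3 : ¬ Even N := by rw [Nat.not_even_iff_odd]; exact ⟨m, hm⟩
    rw [h2, familyOf, if_neg h3, Family.shift, hm]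
    push_cast
    ring

theorem inDiscreteSeriesPlus_nuVec
    (hB : ∀ R, ConvergesOn (fun n => (coeffPlus N g Δ n : ℂ)) R) :
    InDiscreteSeriesPlus N (nuVec N g Δ) := by
  -- The prefactor of ν lowers exponents by ⌈N/2⌉ up to the family shift. Since φ_1 starts at x^N,
  -- the series starts at index N - ⌈N/2⌉ = ⌊N/2⌋, the lowest one in D^+_N.
  set s : ℤ := (((N + 1) / 2 : ℕ) : ℤ) with hs
  set c : FormalSeries := fun k => if 0 ≤ k + s then (coeffPlus N g Δ (k + s).toNat : ℂ) else 0
    with hc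
  refine ⟨c, mem_closure_discreteSeriesPlus fun k hk => ?_, fun x hx => ?_⟩
  · simp only [hc]
    split_ifs with h
    · rw [coeffPlus_of_lt (by omega)]; simp
    · rfl
  · have hinj : Function.Injective fun n : ℕ => (n : ℤ) - s := fun m n h => by
      simp only at h; omega
    refine (hinj.hasSum_iff fun k hk => ?_).mp ?_
    · have h1 : ¬ 0 ≤ k + s := fun h => hk ⟨(k + s).toNat, by simp only; omega⟩
      simp only [hc, if_neg h1, zero_mul]
    · rw [nuVec, phiPlus_eq hB]
      refine (((hB (‖x‖ + 1)).hasSum (lt_add_one ‖x‖)).mul_left _).congr_fun fun n => ?_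
      have h1 : c ((n : ℤ) - s) = (coeffPlus N g Δ n : ℂ) := by
        simp [hc]
      have h2 : (((n : ℤ) - s : ℤ) : ℂ) + (familyOf N).shift = (-(N : ℂ) - 1 / 2) / 2 + n := by
        rw [← familyOf_shift, hs, Int.cast_sub, Int.cast_natCast, Int.cast_natCast]; ring
      simp only [Function.comp, h1, basisFun, h2]
      rw [Complex.cpow_add _ _ hx, Complex.cpow_natCast]
      ring

end DiscreteSeries

end Rabi

end

theorem mainTheorem6 (N : ℕ) (hN : 0 < N) (g Δ : ℝ) (hg : g ≠ 0) (hΔ : Δ ≠ 0)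
    (hG : Rabi.GPlus N g Δ = 0 ∨ Rabi.GMinus N g Δ = 0) :
    Rabi.constraintP N (4 * g ^ 2) (Δ ^ 2) N ≠ 0 ∧
    Rabi.IsNondegenerateExceptional g Δ (N - g ^ 2) ∧
    Rabi.eigenspace g Δ (N - g ^ 2) = Submodule.span ℂ {Rabi.eigenstate N g Δ} ∧
    Rabi.InDiscreteSeriesPlus N (Rabi.nuVec N g Δ) := by
  have hP := Rabi.constraintP_ne_zero hN hg hΔ hG
  obtain ⟨A, B, hB0, hK⟩ := Rabi.exists_coeffK_bound hΔ hG
  obtain ⟨A', hB⟩ := Rabi.exists_coeffPlus_bound hB0 hK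
  have hKc := Rabi.convergesOn_of_norm_le (a := fun n => (Rabi.coeffK N g Δ n : ℂ))
    fun n => by rw [Complex.norm_real]; exact hK n
  have hBc := Rabi.convergesOn_of_norm_le (a := fun n => (Rabi.coeffPlus N g Δ n : ℂ))
    fun n => by rw [Complex.norm_real]; exact hB n
  have hspan : Rabi.eigenspace g Δ (N - g ^ 2) = Submodule.span ℂ {Rabi.eigenstate N g Δ} := by
    refine le_antisymm (Rabi.eigenspace_le_span hN hg hΔ hP hKc hBc) ?_
    rw [Submodule.span_singleton_le_iff_mem]
    exact Rabi.eigenstate_mem_eigenspace hg hΔ hB0 hK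
  refine ⟨hP, ⟨⟨N, rfl⟩, ?_⟩, hspan, Rabi.inDiscreteSeriesPlus_nuVec hBc⟩
  rw [hspan]
  exact finrank_span_singleton
    (Rabi.eigenstate_ne_zero hg (Rabi.phiPlus_ne_zero hΔ hBc))
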